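/- **Setting.** Let $G=(V,E)$ be a finite connected loopless undirected multigraph with $m=|E|$ edges, two distinct terminals $s,t$ and capacities $u\in\mathbb R_{>0}^E$. Orient every edge arbitrarily and let $B\in\mathbb R^{E\times V}$ be the incidence matrix ($B_{ev}=1$ if $v$ is the head of $e$, $-1$ if $v$ is its tail, $0$ otherwise); let $\chi_{st}\in\mathbb R^V$ be $-1$ at $s$, $1$ at $t$ and $0$ elsewhere. Assume that $G$ is *preconditioned*: for some $U$, at least half of the edges join $s$ and $t$ and have capacity $2U$, and all other edges have capacity at most $U$. Let $F^*$ be the maximum $s$-$t$ flow value of $G$ or, more generally, any value for which some $f$ with $-u\le f\le u$ satisfies $B^\top f=F^*\chi_{st}$. For $f\in\mathbb R^E$ let $r(f)_e=(u_e-f_e)^{-2}+(u_e+f_e)^{-2}$, $R(f)=\mathrm{diag}(r(f))$ and $L(f)=B^\top R(f)^{-1}B$. For $0<\mu\le F^*$ the central path flow $f(\mu)$ is the minimizer of $\sum_{e}\bigl(-\log(u_e-f_e)-\log(u_e+f_e)\bigr)$ over all $f$ with $-u<f<u$ and $B^\top f=(F^*-\mu)\chi_{st}$. Write $\|x\|_M=\sqrt{x^\top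 Mx}$, let $M^\dagger$ be the Moore-Penrose pseudoinverse, and write $a\approx_\gamma b$ for $e^{-\gamma}b\le a\le e^{\gamma}b$ (entrywise for vectors, in the Loewner order for symmetric matrices). A flow $f$ is *$\gamma$-centered* for $\mu$ if $-u<f<u$, there is $\varphi\in\mathbb R^V$ with $\bigl\|B\varphi-\bigl(\tfrac{1}{u-f}-\tfrac1{u+f}\bigr)\bigr\|_{R(f)^{-1}}\le\gamma$ (entrywise division), and $\|B^\top f-(F^*-\mu)\chi_{st}\|_{L(f)^\dagger}\le\gamma$. **Lemma 6.10.** There is an absolute constant $c_0>0$ such that the following holds for every $0<c\le c_0$, every such $G$ and $F^*$, every $0<\mu\le F^*$ and every real $k$ with $1\le k\le\frac34\sqrt m$. Put $\epsilon_{\mathrm{step}}=\epsilon_{\mathrm{solve}}=ck^{-3}$ and $\tau=k\epsilon_{\mathrm{step}}^{-1}$. Let $f^{(0)}=f(\mu)$, and for every integer $i\ge 0$ with $i+1\le\tau$ let $$f^{(i+1)}=f^{(i)}+\frac{\epsilon_{\mathrm{step}}\,\mu}{\sqrt m}\,\bigl(\widetilde R^{(i)}\bigr)^{-1}B\,\widetilde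 L^{(i)\dagger}\chi_{st},\qquad \widetilde R^{(i)}=\mathrm{diag}\bigl(\tilde r^{(i)}\bigr),$$ where $\tilde r^{(i)}\in\mathbb R^E$ and the matrix $\widetilde L^{(i)}\in\mathbb R^{V\times V}$ are arbitrary subject to $\tilde r^{(i)}\approx_{\epsilon_{\mathrm{solve}}}r(f^{(i)})$ and $\widetilde L^{(i)}\approx_{\epsilon_{\mathrm{solve}}}L(f^{(i)})$. Then for every integer $0\le i\le\tau$, with $\mu^{(i)}=\mu-\frac{i\,\epsilon_{\mathrm{step}}}{\sqrt m}\mu$: 1. $f^{(i)}$ is $1/1000$-centered for the path parameter $\mu^{(i)}$; 2. the central path flow $f(\mu^{(i)})$ exists and is unique, $\bigl\|R(f^{(i)})^{1/2}\bigl(f^{(i)}-f(\mu^{(i)})\bigr)\bigr\|_\infty\le 0.1$, and $R(f^{(i)})\approx_{0.2}R(f(\mu^{(i)}))$. -/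

import Mathlib

open scoped Matrix

noncomputable section

/-! ### Linear algebra -/

/-- The four Penrose equations: `X` is the Moore-Penrose pseudoinverse of the real matrix `A`. -/
structure IsMoorePenrose {p q : Type*} [Fintype p] [Fintype q]
    (A : Matrix p q ℝ) (X : Matrix q p ℝ) : Prop where
  mul_mul_left : A * X * A = A
  mul_mul_right : X * A * X = X
  symm_left : (A * X)ᵀ = A * X
  symm_right : (X * A)ᵀ = X * A

theorem IsMoorePenrose.unique {p q : Type*} [Fintype p] [Fintype q]
    {A : Matrix p q ℝ} {X Y : Matrix q p ℝ}
    (hX : IsMoorePenrose A X) (hY : IsMoorePenrose A Y) : X = Y := by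
  have h1 : A * X = A * Y := by
    calc A * X = (A * X)ᵀ := hX.symm_left.symm
      _ = ((A * Y) * (A * X))ᵀ := by
          rw [← Matrix.mul_assoc (A * Y), hY.mul_mul_left]
      _ = (A * X) * (A * Y) := by
          rw [Matrix.transpose_mul, hX.symm_left, hY.symm_left]
      _ = A * Y := by rw [← Matrix.mul_assoc, hX.mul_mul_left]
  have h2 : X * A = Y * A := by
    calc X * A = (X * A)ᵀ := hX.symm_right.symm
      _ = ((X * A) * (Y * A))ᵀ := by
          rw [Matrix.mul_assoc X A, ← Matrix.mul_assoc A Y A, hY.mul_mul_left]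
      _ = (Y * A) * (X * A) := by
          rw [Matrix.transpose_mul, hX.symm_right, hY.symm_right]
      _ = Y * A := by
          rw [Matrix.mul_assoc Y A, ← Matrix.mul_assoc A X A, hX.mul_mul_left]
  calc X = X * A * X := hX.mul_mul_right.symm
    _ = Y * A * Y := by rw [h2, Matrix.mul_assoc, h1, ← Matrix.mul_assoc]
    _ = Y := hY.mul_mul_right

theorem exists_isMoorePenrose_of_isHermitian {p : Type*} [Fintype p]
    (A : Matrix p p ℝ) (hA : A.IsHermitian) : ∃ X, IsMoorePenrose A X ∧ Xᵀ = X := by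
  classical
  set φ := Unitary.conjStarAlgAut ℝ (Matrix p p ℝ) hA.eigenvectorUnitary with hφ
  set d : p → ℝ := hA.eigenvalues
  have hAd : A = φ (Matrix.diagonal d) := hA.spectral_theorem
  have htr : ∀ v : p → ℝ, (φ (Matrix.diagonal v))ᵀ = φ (Matrix.diagonal v) := by
    intro v
    rw [← Matrix.conjTranspose_eq_transpose_of_trivial, ← Matrix.star_eq_conjTranspose,
      ← map_star, Matrix.star_eq_conjTranspose, Matrix.diagonal_conjTranspose]
    simp
  have hm : ∀ v w : p → ℝ, φ (Matrix.diagonal v) * φ (Matrix.diagonal w)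
      = φ (Matrix.diagonal fun i => v i * w i) := by
    intro v w
    rw [← map_mul, Matrix.diagonal_mul_diagonal]
  refine ⟨φ (Matrix.diagonal fun i => (d i)⁻¹), ⟨?_, ?_, ?_, ?_⟩, htr _⟩
  · rw [hAd, hm, hm]
    simp
  · rw [hAd, hm, hm]
    congr 2
    funext i
    rcases eq_or_ne (d i) 0 with h | h
    · simp [h]
    · field_simp
  · rw [hAd, hm, htr]
  · rw [hAd, hm, htr]

theorem exists_isMoorePenrose {p q : Type*} [Fintype p] [Fintype q]
    (A : Matrix p q ℝ) : ∃ X, IsMoorePenrose A X := by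
  obtain ⟨P, hP, hPs⟩ := exists_isMoorePenrose_of_isHermitian (Aᵀ * A) (by
    rw [Matrix.IsHermitian, Matrix.conjTranspose_eq_transpose_of_trivial,
      Matrix.transpose_mul, Matrix.transpose_transpose])
  have h1 : A * P * (Aᵀ * A) - A = 0 := by
    rw [← Matrix.conjTranspose_mul_self_eq_zero, Matrix.conjTranspose_eq_transpose_of_trivial]
    have e : (A * P * (Aᵀ * A) - A)ᵀ = (Aᵀ * A) * P * Aᵀ - Aᵀ := by
      simp only [Matrix.transpose_sub, Matrix.transpose_mul, Matrix.transpose_transpose, hPs,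
        Matrix.mul_assoc]
    have h := hP.mul_mul_left
    rw [e, Matrix.sub_mul, Matrix.mul_sub, Matrix.mul_sub]
    have e1 : Aᵀ * A * P * Aᵀ * (A * P * (Aᵀ * A)) = (Aᵀ * A * P * (Aᵀ * A)) * (P * (Aᵀ * A)) := by
      simp only [Matrix.mul_assoc]
    have e2 : Aᵀ * A * P * Aᵀ * A = Aᵀ * A * P * (Aᵀ * A) := by
      simp only [Matrix.mul_assoc]
    have e3 : Aᵀ * (A * P * (Aᵀ * A)) = Aᵀ * A * P * (Aᵀ * A) := by
      simp only [Matrix.mul_assoc]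
    rw [e1, e2, e3, h, ← Matrix.mul_assoc, h]
    simp
  have h2 : A * P * (Aᵀ * A) = A := sub_eq_zero.mp h1
  refine ⟨P * Aᵀ, ⟨?_, ?_, ?_, ?_⟩⟩
  · rw [← Matrix.mul_assoc, Matrix.mul_assoc, h2]
  · have h := hP.mul_mul_right
    have e : P * Aᵀ * A * (P * Aᵀ) = P * (Aᵀ * A) * P * Aᵀ := by
      simp only [Matrix.mul_assoc]
    rw [e, h]
  · simp only [Matrix.transpose_mul, Matrix.transpose_transpose, hPs, Matrix.mul_assoc]
  · have h := hP.symm_right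
    rw [Matrix.mul_assoc]
    exact h

/-- The Moore-Penrose pseudoinverse of a real matrix. -/
def pinv {p q : Type*} [Fintype p] [Fintype q] (A : Matrix p q ℝ) : Matrix q p ℝ :=
  Classical.choose (exists_isMoorePenrose A)

theorem pinv_spec {p q : Type*} [Fintype p] [Fintype q] (A : Matrix p q ℝ) :
    IsMoorePenrose A (pinv A) :=
  Classical.choose_spec (exists_isMoorePenrose A)

/-- The norm `‖x‖_M = √(xᵀ M x)` given by a positive semidefinite matrix `M`. -/
def matNorm {p : Type*} [Fintype p] (M : Matrix p p ℝ) (x : p → ℝ) : ℝ :=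
  Real.sqrt (x ⬝ᵥ (M *ᵥ x))

/-- `a ≈_γ b` (if `b` is positive, then `a` is positive too). -/
def RealApprox (γ a b : ℝ) : Prop :=
  Real.exp (-γ) * b ≤ a ∧ a ≤ Real.exp γ * b

/-- `A ≈_γ B`, that is `exp(-γ) B ≼ A ≼ exp(γ) B` in the Loewner order (if `B` is positive
semidefinite, then `A` is symmetric and positive semidefinite too). -/
def MatApprox {p : Type*} [Fintype p] (γ : ℝ) (A B : Matrix p p ℝ) : Prop :=
  (A - Real.exp (-γ) • B).PosSemidef ∧ (Real.exp γ • B - A).PosSemidef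

/-! ### Undirected capacitated multigraphs with two terminals -/

/-- A loopless undirected multigraph with vertex set `V`, edge set `E`, positive capacities and two
distinct terminals `s`, `t`. The orientation `tail e → head e` is arbitrary and only fixes the sign
of the flow on `e`, which ranges over `[-cap e, cap e]`. -/
structure CapGraph (V E : Type*) where
  tail : E → V
  head : E → V
  tail_ne_head : ∀ e, tail e ≠ head e
  cap : E → ℝ
  cap_pos : ∀ e, 0 < cap e
  s : V
  t : V
  s_ne_t : s ≠ t

namespace CapGraph

variable {V E : Type*} [Fintype V] [Fintype E] [DecidableEq V] [DecidableEq E]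

/-- Connectedness of the underlying undirected graph. -/
def Connected (G : CapGraph V E) : Prop :=
  (SimpleGraph.fromRel fun x y => ∃ e, G.tail e = x ∧ G.head e = y).Connected

/-- At least half of the edges join `s` and `t` and have capacity `2U`; all the others have
capacity at most `U`. -/
def IsPreconditioned (G : CapGraph V E) (U : ℝ) : Prop :=
  ∃ P : Finset E, Fintype.card E ≤ 2 * P.card ∧
    (∀ e ∈ P, ((G.tail e = G.s ∧ G.head e = G.t) ∨ (G.tail e = G.t ∧ G.head e = G.s)) ∧
      G.cap e = 2 * U) ∧
    ∀ e ∉ P, G.cap e ≤ U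

/-- The edge-vertex incidence matrix `B`. -/
def B (G : CapGraph V E) : Matrix E V ℝ :=
  Matrix.of fun e v => if v = G.head e then 1 else if v = G.tail e then -1 else 0

/-- The vector `χ_st`: `-1` at `s`, `1` at `t`, `0` elsewhere. -/
def chi (G : CapGraph V E) : V → ℝ :=
  fun v => if v = G.s then -1 else if v = G.t then 1 else 0

/-- `F` units can be routed from `s` to `t` within the capacities. -/
def Routable (G : CapGraph V E) (F : ℝ) : Prop :=
  ∃ f : E → ℝ, (G.B)ᵀ *ᵥ f = F • G.chi ∧ ∀ e, |f e| ≤ G.cap e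

/-- All residual capacities `u - f` and `u + f` are positive. -/
def StrictlyFeasible (G : CapGraph V E) (f : E → ℝ) : Prop :=
  ∀ e, |f e| < G.cap e

/-- The logarithmic barrier `V(f) = ∑ₑ -log(uₑ - fₑ) - log(uₑ + fₑ)`. -/
def barrier (G : CapGraph V E) (f : E → ℝ) : ℝ :=
  ∑ e, (-Real.log (G.cap e - f e) - Real.log (G.cap e + f e))

/-- `f` is the central path flow `f(μ)`: it minimizes the barrier among the flows that
route `F - μ` units from `s` to `t`. -/
def IsCentralFlow (G : CapGraph V E) (F μ : ℝ) (f : E → ℝ) : Prop :=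
  (G.StrictlyFeasible f ∧ (G.B)ᵀ *ᵥ f = (F - μ) • G.chi) ∧
    ∀ g : E → ℝ, G.StrictlyFeasible g → (G.B)ᵀ *ᵥ g = (F - μ) • G.chi →
      G.barrier f ≤ G.barrier g

/-- The resistances `r(f)ₑ = (uₑ - fₑ)⁻² + (uₑ + fₑ)⁻²`. -/
def res (G : CapGraph V E) (f : E → ℝ) : E → ℝ :=
  fun e => 1 / (G.cap e - f e) ^ 2 + 1 / (G.cap e + f e) ^ 2

/-- The electrical flow map `d ↦ R⁻¹ B M† d` for resistances `r` and a (possibly approximate)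
Laplacian `M`. -/
def elecFlow (G : CapGraph V E) (r : E → ℝ) (M : Matrix V V ℝ) (d : V → ℝ) : E → ℝ :=
  Matrix.diagonal (fun e => (r e)⁻¹) *ᵥ (G.B *ᵥ (pinv M *ᵥ d))

/-- The Laplacian `L(f) = Bᵀ R(f)⁻¹ B`. -/
def lap (G : CapGraph V E) (f : E → ℝ) : Matrix V V ℝ :=
  (G.B)ᵀ * Matrix.diagonal (fun e => (G.res f e)⁻¹) * G.B

/-- `f` is `γ`-centered for the path parameter `μ`: its residual capacities are positive, and its
centrality error (for some dual variable `φ`) and its demand error are at most `γ`. -/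
def IsCentered (G : CapGraph V E) (F γ μ : ℝ) (f : E → ℝ) : Prop :=
  G.StrictlyFeasible f ∧
  (∃ φ : V → ℝ,
    matNorm (Matrix.diagonal fun e => (G.res f e)⁻¹)
      (G.B *ᵥ φ - fun e => 1 / (G.cap e - f e) - 1 / (G.cap e + f e)) ≤ γ) ∧
  matNorm (pinv (G.lap f)) ((G.B)ᵀ *ᵥ f - (F - μ) • G.chi) ≤ γ

end CapGraph

end

open scoped Matrix

set_option linter.unusedSectionVars false

noncomputable section

/-! ### Pseudoinverses of symmetric matrices -/

/-! The iterates are never recentered. A step of electrical energy `O(ε)` creates errors of order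
`ε²` in the gradient condition and in the demand: the nonlinearity of the gradient, the error in the
resistances and the error in the Laplacian each multiply a quantity of size `O(ε)` by another factor
`O(ε)`. These errors simply add up over at most `k/ε` steps, and the point is to compare the local
norms in which they are measured.

Preconditioning controls the central path. Optimality makes the barrier gradient at a central flow a
potential difference, and testing it against feasible flows bounds the `s`-`t` potential drop by
`2m/μ`. Every preconditioning edge sees this drop, so its residual capacities are at least `μ/(3m)`
(`one_div_residual_le`). Hence a step of value `εμ/√m` has energy `O(ε)`.

For two central flows, the pairing of the flow difference with the gradient difference is the
parameter change times the change `D` of the potential drop. It also dominates a multiple of `D²` on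
each of the `m/2` preconditioning edges. Together these bound the pairing by `36m(μ₁-μ₂)²/ν²`
(`dotProduct_grad_sub_le`), where `ν` is a lower bound for both parameters. Over the whole run this
is `O(k²)`, so all resistances along the path agree up to `O(k⁴)` and the norms up to `O(k²)`.

The total error in the norm of the last iterate is thus `O((k/ε)·k²·ε²) = O(c)`. Small errors force
closeness to the central flow (`IsCentralFlow.wnorm_sub_le`), which carries the comparison from the
path to the iterates. A strong induction closes the circle. -/

theorem dotProduct_mulVec_comm_of_symm {p : Type*} [Fintype p] {A : Matrix p p ℝ} (hA : Aᵀ = A)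
    (x y : p → ℝ) : x ⬝ᵥ (A *ᵥ y) = y ⬝ᵥ (A *ᵥ x) := by
  rw [Matrix.dotProduct_mulVec, ← Matrix.mulVec_transpose, hA, dotProduct_comm]

theorem mulVec_pinv_mulVec {p : Type*} [Fintype p] {A : Matrix p p ℝ} (hA : Aᵀ = A)
    {d : p → ℝ} (hd : ∀ z, A *ᵥ z = 0 → d ⬝ᵥ z = 0) : A *ᵥ (pinv A *ᵥ d) = d := by
  have hs := pinv_spec A
  have h1 : A * (A * pinv A) = A := by
    have h := congrArg Matrix.transpose hs.mul_mul_left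
    rwa [Matrix.transpose_mul, hs.symm_left, hA] at h
  -- The residual `z` lies in the kernel of `A`, so it is orthogonal to `d` and to the range of `A`,
  -- hence to itself.
  set z := d - A *ᵥ (pinv A *ᵥ d) with hz
  have hAz : A *ᵥ z = 0 := by
    rw [hz, Matrix.mulVec_sub, Matrix.mulVec_mulVec, Matrix.mulVec_mulVec,
      Matrix.mul_assoc, h1, sub_self]
  have h2 : z ⬝ᵥ z = 0 := by
    nth_rewrite 2 [hz]
    rw [dotProduct_sub, dotProduct_comm z d, hd z hAz, dotProduct_mulVec_comm_of_symm hA, hAz,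
      dotProduct_zero, sub_zero]
  exact (sub_eq_zero.mp (dotProduct_self_eq_zero.mp h2)).symm

/-- Cauchy-Schwarz for a symmetric matrix dominated by a positive semidefinite form. -/
theorem sq_dotProduct_mulVec_le {p : Type*} [Fintype p] {A L : Matrix p p ℝ} (hA : Aᵀ = A)
    (hL : Lᵀ = L) {η : ℝ} (h : ∀ v, |v ⬝ᵥ (A *ᵥ v)| ≤ η * (v ⬝ᵥ (L *ᵥ v))) (x y : p → ℝ) :
    (y ⬝ᵥ (A *ᵥ x)) ^ 2 ≤ η ^ 2 * (y ⬝ᵥ (L *ᵥ y)) * (x ⬝ᵥ (L *ᵥ x)) := by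
  -- Polarization: subtracting the bounds at `s • x + y` and `s • x - y` leaves a quadratic in `s`
  -- that is never negative, so its discriminant is at most 0.
  have key : ∀ s : ℝ, 0 ≤ η * (x ⬝ᵥ (L *ᵥ x)) * (s * s) + (-2 * (y ⬝ᵥ (A *ᵥ x))) * s
      + η * (y ⬝ᵥ (L *ᵥ y)) := by
    intro s
    have h1 := (abs_le.mp (h (s • x + y))).2
    have h2 := (abs_le.mp (h (s • x - y))).1
    simp only [Matrix.mulVec_add, Matrix.mulVec_sub, Matrix.mulVec_smul, dotProduct_add,
      dotProduct_sub, add_dotProduct, sub_dotProduct, smul_dotProduct, dotProduct_smul,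
      smul_eq_mul] at h1 h2
    rw [dotProduct_mulVec_comm_of_symm hA x y, dotProduct_mulVec_comm_of_symm hL x y] at h1 h2
    nlinarith
  have := discrim_le_zero key
  rw [discrim] at this
  nlinarith

/-! ### Weighted Euclidean norms -/

/-- The weighted Euclidean norm `√(∑ₑ wₑ xₑ²)`. -/
def wnorm {E : Type*} [Fintype E] (w x : E → ℝ) : ℝ :=
  ‖WithLp.toLp 2 (fun e => √(w e) * x e)‖

section wnorm
variable {E : Type*} [Fintype E]

theorem wnorm_nonneg (w x : E → ℝ) : 0 ≤ wnorm w x := norm_nonneg _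

theorem wnorm_sq {w : E → ℝ} (hw : ∀ e, 0 ≤ w e) (x : E → ℝ) :
    wnorm w x ^ 2 = ∑ e, w e * x e ^ 2 := by
  rw [wnorm, EuclideanSpace.norm_sq_eq]
  refine Finset.sum_congr rfl fun e _ => ?_
  simp only [Real.norm_eq_abs, sq_abs, mul_pow, Real.sq_sqrt (hw e)]

theorem wnorm_add_le (w x y : E → ℝ) : wnorm w (x + y) ≤ wnorm w x + wnorm w y := by
  have : (WithLp.toLp 2 (fun e => √(w e) * (x + y) e) : EuclideanSpace ℝ E)
      = WithLp.toLp 2 (fun e => √(w e) * x e) + WithLp.toLp 2 (fun e => √(w e) * y e) := by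
    ext e; simp [mul_add]
  rw [wnorm, this]
  exact norm_add_le _ _

theorem wnorm_sub_le (w x y : E → ℝ) : wnorm w (x - y) ≤ wnorm w x + wnorm w y := by
  have : (WithLp.toLp 2 (fun e => √(w e) * (x - y) e) : EuclideanSpace ℝ E)
      = WithLp.toLp 2 (fun e => √(w e) * x e) - WithLp.toLp 2 (fun e => √(w e) * y e) := by
    ext e; simp [mul_sub]
  rw [wnorm, this]
  exact norm_sub_le _ _

theorem wnorm_sum_le {ι : Type*} (s : Finset ι) (w : E → ℝ) (x : ι → E → ℝ) :
    wnorm w (∑ i ∈ s, x i) ≤ ∑ i ∈ s, wnorm w (x i) := by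
  classical
  induction s using Finset.induction_on with
  | empty =>
    have : (WithLp.toLp 2 (fun e => √(w e) * (0 : E → ℝ) e) : EuclideanSpace ℝ E) = 0 := by
      ext e; simp
    simp only [Finset.sum_empty]
    rw [wnorm, this, norm_zero]
  | insert a s ha ih =>
    rw [Finset.sum_insert ha, Finset.sum_insert ha]
    exact (wnorm_add_le _ _ _).trans (by gcongr)

theorem wnorm_le_mul {w w' : E → ℝ} (hw : ∀ e, 0 ≤ w e) (hw' : ∀ e, 0 ≤ w' e) {x z : E → ℝ}
    {a : ℝ} (ha : 0 ≤ a) (h : ∀ e, w e * x e ^ 2 ≤ a ^ 2 * (w' e * z e ^ 2)) :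
    wnorm w x ≤ a * wnorm w' z := by
  refine (abs_le_of_sq_le_sq' ?_ (mul_nonneg ha (wnorm_nonneg _ _))).2
  rw [mul_pow, wnorm_sq hw, wnorm_sq hw', Finset.mul_sum]
  exact Finset.sum_le_sum fun e _ => h e

theorem abs_dotProduct_le_wnorm {w : E → ℝ} (hw : ∀ e, 0 < w e) (x y : E → ℝ) :
    |x ⬝ᵥ y| ≤ wnorm w x * wnorm (fun e => (w e)⁻¹) y := by
  refine abs_le_of_sq_le_sq ?_ (mul_nonneg (wnorm_nonneg _ _) (wnorm_nonneg _ _))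
  rw [mul_pow, wnorm_sq (fun e => (hw e).le), wnorm_sq (fun e => (inv_pos.mpr (hw e)).le)]
  refine Finset.sum_sq_le_sum_mul_sum_of_sq_le_mul _ ?_ ?_ ?_
  · intro e _; have := hw e; positivity
  · intro e _; have := hw e; positivity
  · intro e _; have := (hw e).ne'; exact le_of_eq (by field_simp)

theorem mul_sq_le_wnorm_sq {w : E → ℝ} (hw : ∀ e, 0 ≤ w e) (x : E → ℝ) (e : E) :
    w e * x e ^ 2 ≤ wnorm w x ^ 2 := by
  rw [wnorm_sq hw]
  exact Finset.single_le_sum (f := fun e => w e * x e ^ 2)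
    (fun e _ => mul_nonneg (hw e) (sq_nonneg _)) (Finset.mem_univ e)

end wnorm

/-! ### Scalar estimates for the barrier `-log (u - x) - log (u + x)` -/

theorem resistance_pos {u a : ℝ} (ha : |a| < u) : 0 < 1 / (u - a) ^ 2 + 1 / (u + a) ^ 2 := by
  have h := abs_lt.mp ha
  have h1 : 0 < u - a := by linarith
  have h2 : 0 < u + a := by linarith
  positivity

/-- Each of the two terms of the resistance alone obeys the bound. This turns a local norm bound
into a relative change of both residual capacities. -/
theorem abs_le_mul_residual {u a d ρ : ℝ} (ha : |a| < u) (hρ : 0 ≤ ρ)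
    (hd : (1 / (u - a) ^ 2 + 1 / (u + a) ^ 2) * d ^ 2 ≤ ρ ^ 2) :
    |d| ≤ ρ * (u - a) ∧ |d| ≤ ρ * (u + a) := by
  have h := abs_lt.mp ha
  have h1 : 0 < u - a := by linarith
  have h2 : 0 < u + a := by linarith
  have e1 : 0 ≤ 1 / (u + a) ^ 2 * d ^ 2 := by positivity
  have e2 : 0 ≤ 1 / (u - a) ^ 2 * d ^ 2 := by positivity
  constructor
  · refine abs_le_of_sq_le_sq ?_ (by positivity)
    have : 1 / (u - a) ^ 2 * d ^ 2 ≤ ρ ^ 2 := by nlinarith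
    rw [div_mul_eq_mul_div, div_le_iff₀ (by positivity)] at this
    rw [mul_pow]; linarith
  · refine abs_le_of_sq_le_sq ?_ (by positivity)
    have : 1 / (u + a) ^ 2 * d ^ 2 ≤ ρ ^ 2 := by nlinarith
    rw [div_mul_eq_mul_div, div_le_iff₀ (by positivity)] at this
    rw [mul_pow]; linarith

theorem abs_lt_of_residual {u a b ρ : ℝ} (ha : |a| < u) (hρ : 0 ≤ ρ) (hρ1 : ρ < 1)
    (hd : (1 / (u - a) ^ 2 + 1 / (u + a) ^ 2) * (b - a) ^ 2 ≤ ρ ^ 2) : |b| < u := by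
  obtain ⟨h1, h2⟩ := abs_le_mul_residual ha hρ hd
  have h := abs_lt.mp ha
  have h1' := abs_le.mp h1
  have h2' := abs_le.mp h2
  rw [abs_lt]
  constructor <;> nlinarith

theorem one_div_sq_le_of_mul_le {x y t : ℝ} (hx : 0 < x) (ht : 0 < t) (h : t * x ≤ y) :
    t ^ 2 * (1 / y ^ 2) ≤ 1 / x ^ 2 := by
  have hy : 0 < y := lt_of_lt_of_le (by positivity) h
  rw [mul_one_div, div_le_div_iff₀ (by positivity) (by positivity), one_mul, ← mul_pow]
  gcongr

theorem resistance_mul_le {u a b ρ : ℝ} (ha : |a| < u) (hρ : 0 ≤ ρ) (hρ1 : ρ < 1)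
    (hd : (1 / (u - a) ^ 2 + 1 / (u + a) ^ 2) * (b - a) ^ 2 ≤ ρ ^ 2) :
    (1 - ρ) ^ 2 * (1 / (u - b) ^ 2 + 1 / (u + b) ^ 2) ≤ 1 / (u - a) ^ 2 + 1 / (u + a) ^ 2 ∧
    1 / (u - a) ^ 2 + 1 / (u + a) ^ 2 ≤ (1 + ρ) ^ 2 * (1 / (u - b) ^ 2 + 1 / (u + b) ^ 2) := by
  obtain ⟨h1, h2⟩ := abs_le_mul_residual ha hρ hd
  have hb := abs_lt.mp (abs_lt_of_residual ha hρ hρ1 hd)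
  have h := abs_lt.mp ha
  have h1' := abs_le.mp h1
  have h2' := abs_le.mp h2
  constructor
  · rw [mul_add]
    exact add_le_add (one_div_sq_le_of_mul_le (by linarith) (by linarith) (by linarith))
      (one_div_sq_le_of_mul_le (by linarith) (by linarith) (by linarith))
  · have e : ∀ x y : ℝ, 0 < x → 0 < y → y ≤ (1 + ρ) * x → 1 / x ^ 2 ≤ (1 + ρ) ^ 2 * (1 / y ^ 2) := by
      intro x y hx hy hxy
      rw [mul_one_div, div_le_div_iff₀ (by positivity) (by positivity), one_mul, ← mul_pow]
      gcongr
    rw [mul_add]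
    exact add_le_add (e _ _ (by linarith) (by linarith) (by linarith))
      (e _ _ (by linarith) (by linarith) (by linarith))

theorem barrierDeriv_sub {u a b : ℝ} (ha : |a| < u) (hb : |b| < u) :
    (1 / (u - a) - 1 / (u + a)) - (1 / (u - b) - 1 / (u + b))
      = (a - b) * (1 / ((u - a) * (u - b)) + 1 / ((u + a) * (u + b))) := by
  have ha' := abs_lt.mp ha
  have hb' := abs_lt.mp hb
  have h1 : u - a ≠ 0 := by linarith
  have h2 : u + a ≠ 0 := by linarith
  have h3 : u - b ≠ 0 := by linarith
  have h4 : u + b ≠ 0 := by linarith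
  field_simp
  ring

/-- The linearization error of the derivative of the barrier. -/
theorem abs_barrierDeriv_sub_linear_le {u a b ρ : ℝ} (ha : |a| < u) (hρ : 0 ≤ ρ) (hρ1 : ρ < 1)
    (hd : (1 / (u - a) ^ 2 + 1 / (u + a) ^ 2) * (b - a) ^ 2 ≤ ρ ^ 2) :
    |(1 / (u - b) - 1 / (u + b)) - (1 / (u - a) - 1 / (u + a))
        - (1 / (u - a) ^ 2 + 1 / (u + a) ^ 2) * (b - a)|
      ≤ ρ / (1 - ρ) * ((1 / (u - a) ^ 2 + 1 / (u + a) ^ 2) * |b - a|) := by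
  obtain ⟨h1, h2⟩ := abs_le_mul_residual ha hρ hd
  have hb' := abs_lt_of_residual ha hρ hρ1 hd
  have hb := abs_lt.mp hb'
  have h := abs_lt.mp ha
  have h1' := abs_le.mp h1
  have h2' := abs_le.mp h2
  have p1 : 0 < u - a := by linarith
  have p2 : 0 < u + a := by linarith
  have p3 : 0 < u - b := by linarith
  have p4 : 0 < u + b := by linarith
  have p5 : 0 < 1 - ρ := by linarith
  have e : (1 / (u - b) - 1 / (u + b)) - (1 / (u - a) - 1 / (u + a))
        - (1 / (u - a) ^ 2 + 1 / (u + a) ^ 2) * (b - a)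
      = (1 / (u - a) ^ 2 * (b - a)) * ((b - a) / (u - b))
        - (1 / (u + a) ^ 2 * (b - a)) * ((b - a) / (u + b)) := by
    field_simp
    ring
  have q1 : |(b - a) / (u - b)| ≤ ρ / (1 - ρ) := by
    rw [abs_div, abs_of_pos p3, div_le_div_iff₀ p3 p5]
    nlinarith
  have q2 : |(b - a) / (u + b)| ≤ ρ / (1 - ρ) := by
    rw [abs_div, abs_of_pos p4, div_le_div_iff₀ p4 p5]
    nlinarith
  rw [e]
  refine (abs_sub _ _).trans ?_
  rw [abs_mul, abs_mul, abs_mul, abs_mul, abs_of_pos (by positivity : 0 < 1 / (u - a) ^ 2),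
    abs_of_pos (by positivity : 0 < 1 / (u + a) ^ 2)]
  have r1 : 1 / (u - a) ^ 2 * |b - a| * |(b - a) / (u - b)|
      ≤ 1 / (u - a) ^ 2 * |b - a| * (ρ / (1 - ρ)) := by gcongr
  have r2 : 1 / (u + a) ^ 2 * |b - a| * |(b - a) / (u + b)|
      ≤ 1 / (u + a) ^ 2 * |b - a| * (ρ / (1 - ρ)) := by gcongr
  linarith

/-- The residuals at `b` are at most `1 + ρ` times those at `a`. Since `ρ < 1` is not needed, the
bound applies to a distance not yet known to be small. -/
theorem resistance_le_secant {u a b ρ : ℝ} (ha : |a| < u) (hb : |b| < u) (hρ : 0 ≤ ρ)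
    (hd : (1 / (u - a) ^ 2 + 1 / (u + a) ^ 2) * (a - b) ^ 2 ≤ ρ ^ 2) :
    1 / (u - a) ^ 2 + 1 / (u + a) ^ 2
      ≤ (1 + ρ) * (1 / ((u - a) * (u - b)) + 1 / ((u + a) * (u + b))) := by
  obtain ⟨h1, h2⟩ := abs_le_mul_residual ha hρ hd
  have h1' := abs_le.mp h1
  have h2' := abs_le.mp h2
  have h := abs_lt.mp ha
  have h' := abs_lt.mp hb
  have e : ∀ x y : ℝ, 0 < x → 0 < y → y ≤ (1 + ρ) * x → 1 / x ^ 2 ≤ (1 + ρ) * (1 / (x * y)) := by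
    intro x y hx hy hxy
    rw [mul_one_div, div_le_div_iff₀ (by positivity) (by positivity)]
    nlinarith
  rw [mul_add]
  exact add_le_add (e _ _ (by linarith) (by linarith) (by linarith))
      (e _ _ (by linarith) (by linarith) (by linarith))

/-- Residual capacities whose secant energy is at most `S` differ by a factor at most `S + 2`. -/
theorem resistance_le_of_secant_le {u a b S : ℝ} (ha : |a| < u) (hb : |b| < u)
    (hS : (a - b) ^ 2 * (1 / ((u - a) * (u - b)) + 1 / ((u + a) * (u + b))) ≤ S) :
    1 / (u - a) ^ 2 + 1 / (u + a) ^ 2 ≤ (S + 2) ^ 2 * (1 / (u - b) ^ 2 + 1 / (u + b) ^ 2) := by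
  have h := abs_lt.mp ha
  have h' := abs_lt.mp hb
  have p1 : 0 < u - a := by linarith
  have p2 : 0 < u + a := by linarith
  have p3 : 0 < u - b := by linarith
  have p4 : 0 < u + b := by linarith
  have t1 : 0 ≤ (a - b) ^ 2 * (1 / ((u - a) * (u - b))) := by positivity
  have t2 : 0 ≤ (a - b) ^ 2 * (1 / ((u + a) * (u + b))) := by positivity
  have e : ∀ x y : ℝ, 0 < x → 0 < y → (x - y) ^ 2 * (1 / (x * y)) ≤ S →
      1 / x ^ 2 ≤ (S + 2) ^ 2 * (1 / y ^ 2) := by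
    intro x y hx hy hxy
    have hS0 : 0 ≤ S := le_trans (by positivity) hxy
    rw [mul_one_div, div_le_iff₀ (by positivity)] at hxy
    -- If `y > (S + 2) * x`, then `(x - y)² ≥ y * (y - 2 * x) > S * x * y`.
    have hyx : y ≤ (S + 2) * x := by
      by_contra hc
      push Not at hc
      nlinarith [sq_nonneg x]
    rw [mul_one_div, div_le_div_iff₀ (by positivity) (by positivity), one_mul, ← mul_pow]
    gcongr
  rw [mul_add]
  refine add_le_add (e _ _ p1 p3 ?_) (e _ _ p2 p4 ?_)
  · calc _ = (a - b) ^ 2 * (1 / ((u - a) * (u - b))) := by ring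
      _ ≤ S := by linarith
  · calc _ = (a - b) ^ 2 * (1 / ((u + a) * (u + b))) := by ring
      _ ≤ S := by linarith

/-! ### The graph: gradient, demands, Laplacian -/

namespace CapGraph

variable {V E : Type*} [Fintype V] [Fintype E] [DecidableEq V] [DecidableEq E]

/-- The gradient of the barrier. -/
def grad (G : CapGraph V E) (f : E → ℝ) : E → ℝ :=
  fun e => 1 / (G.cap e - f e) - 1 / (G.cap e + f e)

theorem res_pos {G : CapGraph V E} {f : E → ℝ} (hf : G.StrictlyFeasible f) (e : E) :
    0 < G.res f e := resistance_pos (hf e)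

theorem chi_dotProduct (G : CapGraph V E) (y : V → ℝ) : G.chi ⬝ᵥ y = y G.t - y G.s := by
  have : G.chi = Pi.single G.t 1 - Pi.single G.s 1 := by
    ext v
    simp only [chi, Pi.sub_apply, Pi.single_apply]
    by_cases h1 : v = G.s
    · subst h1; simp [G.s_ne_t]
    · simp [h1]
  rw [this, sub_dotProduct]
  simp

theorem B_mulVec (G : CapGraph V E) (y : V → ℝ) (e : E) :
    (G.B *ᵥ y) e = y (G.head e) - y (G.tail e) := by
  have : G.B e = Pi.single (G.head e) 1 - Pi.single (G.tail e) 1 := by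
    ext v
    simp only [B, Matrix.of_apply, Pi.sub_apply, Pi.single_apply]
    by_cases h1 : v = G.head e
    · subst h1; simp [(G.tail_ne_head e).symm]
    · by_cases h2 : v = G.tail e <;> simp [h1, h2, G.tail_ne_head e]
  change G.B e ⬝ᵥ y = _
  rw [this, sub_dotProduct]
  simp

theorem transpose_mulVec_dotProduct (G : CapGraph V E) (q : E → ℝ) (y : V → ℝ) :
    ((G.B)ᵀ *ᵥ q) ⬝ᵥ y = q ⬝ᵥ (G.B *ᵥ y) := by
  rw [Matrix.mulVec_transpose, Matrix.dotProduct_mulVec]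

theorem lap_transpose (G : CapGraph V E) (f : E → ℝ) : (G.lap f)ᵀ = G.lap f := by
  simp [lap, Matrix.transpose_mul, Matrix.mul_assoc]

theorem lap_mulVec (G : CapGraph V E) (f : E → ℝ) (x : V → ℝ) :
    G.lap f *ᵥ x = (G.B)ᵀ *ᵥ (fun e => (G.res f e)⁻¹ * (G.B *ᵥ x) e) := by
  rw [lap, ← Matrix.mulVec_mulVec, ← Matrix.mulVec_mulVec]
  congr 1
  ext e
  rw [Matrix.mulVec_diagonal]

theorem dotProduct_lap_mulVec (G : CapGraph V E) (f : E → ℝ) (x y : V → ℝ) :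
    y ⬝ᵥ (G.lap f *ᵥ x) = ∑ e, (G.res f e)⁻¹ * (G.B *ᵥ y) e * (G.B *ᵥ x) e := by
  rw [lap_mulVec, dotProduct_comm, transpose_mulVec_dotProduct]
  exact Finset.sum_congr rfl fun e _ => by ring

theorem dotProduct_lap_self {G : CapGraph V E} {f : E → ℝ} (hf : G.StrictlyFeasible f)
    (x : V → ℝ) :
    x ⬝ᵥ (G.lap f *ᵥ x) = wnorm (fun e => (G.res f e)⁻¹) (G.B *ᵥ x) ^ 2 := by
  rw [dotProduct_lap_mulVec, wnorm_sq (fun e => (inv_pos.mpr (res_pos hf e)).le)]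
  exact Finset.sum_congr rfl fun e _ => by ring

end CapGraph
namespace CapGraph
variable {V E : Type*} [Fintype V] [Fintype E] [DecidableEq V] [DecidableEq E]

/-! ### Demands that are small for the electrical energy -/

/-- A kernel vector of the Laplacian has zero energy, so the dual bound makes `d` orthogonal to the
kernel. The dual form of the demand error is used throughout because it adds up and changes norms
without pseudoinverses. -/
theorem lap_mulVec_pinv {G : CapGraph V E} {f : E → ℝ} (hf : G.StrictlyFeasible f) {d : V → ℝ}
    {a : ℝ} (hd : ∀ y, |d ⬝ᵥ y| ≤ a * wnorm (fun e => (G.res f e)⁻¹) (G.B *ᵥ y)) :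
    G.lap f *ᵥ (pinv (G.lap f) *ᵥ d) = d := by
  refine mulVec_pinv_mulVec (G.lap_transpose f) fun z hz => ?_
  have h1 := dotProduct_lap_self hf z
  rw [hz, dotProduct_zero] at h1
  have h2 := hd z
  rw [pow_eq_zero_iff two_ne_zero |>.mp h1.symm, mul_zero] at h2
  exact abs_eq_zero.mp (le_antisymm h2 (abs_nonneg _))

theorem wnorm_B_pinv_le {G : CapGraph V E} {f : E → ℝ} (hf : G.StrictlyFeasible f) {d : V → ℝ}
    {a : ℝ} (ha : 0 ≤ a)
    (hd : ∀ y, |d ⬝ᵥ y| ≤ a * wnorm (fun e => (G.res f e)⁻¹) (G.B *ᵥ y)) :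
    wnorm (fun e => (G.res f e)⁻¹) (G.B *ᵥ (pinv (G.lap f) *ᵥ d)) ≤ a := by
  have h1 := dotProduct_lap_self hf (pinv (G.lap f) *ᵥ d)
  rw [lap_mulVec_pinv hf hd, dotProduct_comm] at h1
  have h2 := (le_abs_self _).trans (hd (pinv (G.lap f) *ᵥ d))
  rw [h1] at h2
  have h3 := wnorm_nonneg (fun e => (G.res f e)⁻¹) (G.B *ᵥ (pinv (G.lap f) *ᵥ d))
  by_contra hc
  push Not at hc
  nlinarith

theorem matNorm_pinv_lap_le {G : CapGraph V E} {f : E → ℝ} (hf : G.StrictlyFeasible f)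
    {d : V → ℝ} {a : ℝ} (ha : 0 ≤ a)
    (hd : ∀ y, |d ⬝ᵥ y| ≤ a * wnorm (fun e => (G.res f e)⁻¹) (G.B *ᵥ y)) :
    matNorm (pinv (G.lap f)) d ≤ a := by
  have h1 := dotProduct_lap_self hf (pinv (G.lap f) *ᵥ d)
  rw [lap_mulVec_pinv hf hd, dotProduct_comm] at h1
  rw [matNorm, h1, Real.sqrt_sq (wnorm_nonneg _ _)]
  exact wnorm_B_pinv_le hf ha hd

theorem matNorm_diagonal {r : E → ℝ} (hr : ∀ e, 0 ≤ r e) (x : E → ℝ) :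
    matNorm (Matrix.diagonal r) x = wnorm r x := by
  rw [matNorm, ← Real.sqrt_sq (wnorm_nonneg r x), wnorm_sq hr]
  congr 1
  refine Finset.sum_congr rfl fun e _ => ?_
  rw [Matrix.mulVec_diagonal]; ring

/-! ### Central flows -/

/-- Minimizing the barrier means maximizing the product of all residual capacities. This product is
continuous on the compact set of feasible flows and vanishes on its boundary, so a maximizer with
positive value is strictly feasible. -/
theorem exists_isCentralFlow {G : CapGraph V E} {F μ : ℝ} (hF : G.Routable F) (hμ : 0 < μ)
    (hμF : μ ≤ F) : ∃ g, G.IsCentralFlow F μ g := by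
  obtain ⟨fs, hfs, hcap⟩ := hF
  have hFpos : 0 < F := hμ.trans_le hμF
  set K : Set (E → ℝ) := {g | (∀ e, |g e| ≤ G.cap e) ∧ (G.B)ᵀ *ᵥ g = (F - μ) • G.chi} with hK
  have hKc : IsCompact K := by
    refine IsCompact.of_isClosed_subset
      (isCompact_univ_pi fun e => isCompact_Icc (a := -G.cap e) (b := G.cap e)) ?_ ?_
    · refine IsClosed.inter ?_ ?_
      · have : {g : E → ℝ | ∀ e, |g e| ≤ G.cap e} = ⋂ e, {g | |g e| ≤ G.cap e} := by
          ext; simp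
        change IsClosed {g : E → ℝ | ∀ e, |g e| ≤ G.cap e}
        rw [this]
        exact isClosed_iInter fun e => isClosed_le (by fun_prop) (by fun_prop)
      · exact isClosed_eq (Continuous.matrix_mulVec continuous_const continuous_id)
          continuous_const
    · intro g hg e _
      exact abs_le.mp (hg.1 e)
  -- Scaling a flow of value `F` by a factor less than 1 gives a strictly feasible competitor.
  set f0 : E → ℝ := ((F - μ) / F) • fs with hf0
  have h0 : ∀ e, |f0 e| < G.cap e := by
    intro e
    rw [hf0, Pi.smul_apply, smul_eq_mul, abs_mul,
      abs_of_nonneg (div_nonneg (by linarith) hFpos.le)]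
    have h1 : (F - μ) / F < 1 := by rw [div_lt_one hFpos]; linarith
    have h2 : 0 ≤ (F - μ) / F := div_nonneg (by linarith) hFpos.le
    nlinarith [hcap e, abs_nonneg (fs e), G.cap_pos e]
  have h0d : (G.B)ᵀ *ᵥ f0 = (F - μ) • G.chi := by
    rw [hf0, Matrix.mulVec_smul, hfs, smul_smul, div_mul_cancel₀ _ hFpos.ne']
  obtain ⟨g, hgK, hg⟩ := hKc.exists_isMaxOn ⟨f0, fun e => (h0 e).le, h0d⟩
    (f := fun g : E → ℝ => ∏ e, ((G.cap e - g e) * (G.cap e + g e)))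
    (Continuous.continuousOn (by fun_prop))
  have hfac : ∀ h : E → ℝ, G.StrictlyFeasible h → ∀ e,
      0 < G.cap e - h e ∧ 0 < G.cap e + h e := by
    intro h hh e
    have := abs_lt.mp (hh e)
    constructor <;> linarith
  have hgpos : 0 < ∏ e, ((G.cap e - g e) * (G.cap e + g e)) :=
    lt_of_lt_of_le (Finset.prod_pos fun e _ => mul_pos (hfac f0 h0 e).1 (hfac f0 h0 e).2)
      (hg (show f0 ∈ K from ⟨fun e => (h0 e).le, h0d⟩))
  have hgs : G.StrictlyFeasible g := by
    intro e
    refine lt_of_le_of_ne (hgK.1 e) fun heq => ?_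
    have hne := Finset.prod_ne_zero_iff.mp hgpos.ne' e (Finset.mem_univ e)
    apply hne
    have : G.cap e ^ 2 = g e ^ 2 := by rw [← heq, sq_abs]
    linear_combination this
  have hbar : ∀ h : E → ℝ, G.StrictlyFeasible h →
      G.barrier h = -Real.log (∏ e, ((G.cap e - h e) * (G.cap e + h e))) := by
    intro h hh
    rw [Real.log_prod (fun e _ => (mul_pos (hfac h hh e).1 (hfac h hh e).2).ne'), barrier,
      ← Finset.sum_neg_distrib]
    refine Finset.sum_congr rfl fun e _ => ?_
    rw [Real.log_mul (hfac h hh e).1.ne' (hfac h hh e).2.ne']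
    ring
  refine ⟨g, ⟨hgs, hgK.2⟩, fun h hh hd => ?_⟩
  rw [hbar g hgs, hbar h hh]
  exact neg_le_neg (Real.log_le_log
    (Finset.prod_pos fun e _ => mul_pos (hfac h hh e).1 (hfac h hh e).2)
    (hg (show h ∈ K from ⟨fun e => (hh e).le, hd⟩)))

theorem IsCentralFlow.dotProduct_grad_eq_zero {G : CapGraph V E} {F μ : ℝ} {g : E → ℝ}
    (hg : G.IsCentralFlow F μ g) {z : E → ℝ} (hz : (G.B)ᵀ *ᵥ z = 0) : z ⬝ᵥ G.grad g = 0 := by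
  obtain ⟨⟨hs, hd⟩, hmin⟩ := hg
  have hder : HasDerivAt (fun t : ℝ => G.barrier (g + t • z)) (z ⬝ᵥ G.grad g) 0 := by
    have : ∀ e ∈ (Finset.univ : Finset E), HasDerivAt
        (fun t : ℝ => -Real.log (G.cap e - (g + t • z) e) - Real.log (G.cap e + (g + t • z) e))
        (z e * G.grad g e) 0 := by
      intro e _
      have hb := abs_lt.mp (hs e)
      have hlin : HasDerivAt (fun t : ℝ => (g + t • z) e) (z e) 0 := by
        simpa using ((hasDerivAt_id (0 : ℝ)).mul_const (z e)).const_add (g e)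
      have h1 := (hlin.const_sub (G.cap e)).log (by simp; linarith)
      have h2 := (hlin.const_add (G.cap e)).log (by simp; linarith)
      refine (h1.neg.sub h2).congr_deriv ?_
      simp only [zero_smul, add_zero, grad]
      ring
    exact HasDerivAt.fun_sum this
  refine IsLocalMin.hasDerivAt_eq_zero ?_ hder
  have hev : ∀ᶠ t : ℝ in nhds 0, ∀ e, |(g + t • z) e| < G.cap e := by
    rw [Filter.eventually_all]
    intro e
    have hc : Continuous fun t : ℝ => |(g + t • z) e| := by
      simp only [Pi.add_apply, Pi.smul_apply, smul_eq_mul]; fun_prop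
    exact (hc.tendsto 0).eventually (gt_mem_nhds (by simpa using hs e))
  filter_upwards [hev] with t ht
  rw [zero_smul, add_zero]
  refine hmin _ ht ?_
  rw [Matrix.mulVec_add, Matrix.mulVec_smul, hz, smul_zero, add_zero, hd]

/-- The optimality condition: the gradient of the barrier at a central flow is a potential
difference. -/
theorem IsCentralFlow.exists_grad_eq {G : CapGraph V E} {F μ : ℝ} {g : E → ℝ}
    (hg : G.IsCentralFlow F μ g) : ∃ φ, G.grad g = G.B *ᵥ φ := by
  have hs := pinv_spec G.B
  have h1 : (G.B)ᵀ * (G.B * pinv G.B) = (G.B)ᵀ := by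
    have h := congrArg Matrix.transpose hs.mul_mul_left
    rwa [Matrix.transpose_mul, hs.symm_left] at h
  -- The least squares potential: the residual `z` is a circulation, hence orthogonal both to the
  -- gradient and to `G.B *ᵥ φ`.
  set φ := pinv G.B *ᵥ G.grad g with hφ
  set z := G.grad g - G.B *ᵥ φ with hz
  have hBz : (G.B)ᵀ *ᵥ z = 0 := by
    rw [hz, hφ, Matrix.mulVec_sub, Matrix.mulVec_mulVec, Matrix.mulVec_mulVec,
      Matrix.mul_assoc, h1, sub_self]
  have h2 := hg.dotProduct_grad_eq_zero hBz
  have h3 : z ⬝ᵥ (G.B *ᵥ φ) = 0 := by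
    rw [← transpose_mulVec_dotProduct, hBz, zero_dotProduct]
  have h4 : z ⬝ᵥ z = 0 := by
    nth_rewrite 2 [hz]
    rw [dotProduct_sub, h2, h3, sub_zero]
  exact ⟨φ, sub_eq_zero.mp (dotProduct_self_eq_zero.mp h4)⟩

theorem dotProduct_grad_sub {G : CapGraph V E} {f g : E → ℝ} (hf : G.StrictlyFeasible f)
    (hg : G.StrictlyFeasible g) :
    (f - g) ⬝ᵥ (G.grad f - G.grad g) = ∑ e, (f e - g e) ^ 2 *
      (1 / ((G.cap e - f e) * (G.cap e - g e)) + 1 / ((G.cap e + f e) * (G.cap e + g e))) := by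
  refine Finset.sum_congr rfl fun e _ => ?_
  simp only [Pi.sub_apply, grad]
  rw [barrierDeriv_sub (hf e) (hg e)]
  ring

theorem secant_pos {G : CapGraph V E} {f g : E → ℝ} (hf : G.StrictlyFeasible f)
    (hg : G.StrictlyFeasible g) (e : E) :
    0 < 1 / ((G.cap e - f e) * (G.cap e - g e)) + 1 / ((G.cap e + f e) * (G.cap e + g e)) := by
  have h := abs_lt.mp (hf e)
  have h' := abs_lt.mp (hg e)
  have p1 : 0 < G.cap e - f e := by linarith
  have p2 : 0 < G.cap e + f e := by linarith
  have p3 : 0 < G.cap e - g e := by linarith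
  have p4 : 0 < G.cap e + g e := by linarith
  positivity

/-- The difference is a circulation, so it pairs to zero with both gradients, while the secant form
of the pairing is a sum of squares with positive weights. -/
theorem IsCentralFlow.unique {G : CapGraph V E} {F μ : ℝ} {f g : E → ℝ}
    (hf : G.IsCentralFlow F μ f) (hg : G.IsCentralFlow F μ g) : f = g := by
  have hB : (G.B)ᵀ *ᵥ (f - g) = 0 := by
    rw [Matrix.mulVec_sub, hf.1.2, hg.1.2, sub_self]
  have h := dotProduct_grad_sub hf.1.1 hg.1.1
  rw [dotProduct_sub, hf.dotProduct_grad_eq_zero hB, hg.dotProduct_grad_eq_zero hB,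
    sub_self] at h
  have hnn : ∀ e ∈ (Finset.univ : Finset E), 0 ≤ (f e - g e) ^ 2 *
      (1 / ((G.cap e - f e) * (G.cap e - g e)) + 1 / ((G.cap e + f e) * (G.cap e + g e))) :=
    fun e _ => mul_nonneg (sq_nonneg _) (secant_pos hf.1.1 hg.1.1 e).le
  ext e
  have h1 := (Finset.sum_eq_zero_iff_of_nonneg hnn).mp h.symm e (Finset.mem_univ e)
  rcases mul_eq_zero.mp h1 with h2 | h2
  · exact sub_eq_zero.mp (pow_eq_zero_iff two_ne_zero |>.mp h2)
  · exact absurd h2 (secant_pos hf.1.1 hg.1.1 e).ne'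

/-! ### Preconditioned graphs -/

/-- `P` is a set of edges that witnesses preconditioning. -/
def IsPreconditioner (G : CapGraph V E) (U : ℝ) (P : Finset E) : Prop :=
  Fintype.card E ≤ 2 * P.card ∧
    (∀ e ∈ P, ((G.tail e = G.s ∧ G.head e = G.t) ∨ (G.tail e = G.t ∧ G.head e = G.s)) ∧
      G.cap e = 2 * U) ∧
    ∀ e ∉ P, G.cap e ≤ U

theorem IsPreconditioner.B_mulVec_sq {G : CapGraph V E} {U : ℝ} {P : Finset E}
    (hP : G.IsPreconditioner U P) {e : E} (he : e ∈ P) (y : V → ℝ) :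
    (G.B *ᵥ y) e ^ 2 = (G.chi ⬝ᵥ y) ^ 2 := by
  rw [B_mulVec, chi_dotProduct]
  rcases (hP.2.1 e he).1 with ⟨h1, h2⟩ | ⟨h1, h2⟩
  · rw [h1, h2]
  · rw [h1, h2]; ring

theorem IsPreconditioner.cap_le {G : CapGraph V E} {U : ℝ} {P : Finset E}
    (hP : G.IsPreconditioner U P) (e : E) : G.cap e ≤ 2 * U := by
  by_cases he : e ∈ P
  · exact (hP.2.1 e he).2.le
  · have h1 := hP.2.2 e he
    linarith [G.cap_pos e]

theorem IsPreconditioner.flow_le {G : CapGraph V E} {U F : ℝ} {P : Finset E}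
    (hP : G.IsPreconditioner U P) (hF : G.Routable F) : F ≤ Fintype.card E * (2 * U) := by
  obtain ⟨f, hf, hcap⟩ := hF
  have h1 := transpose_mulVec_dotProduct G f (Pi.single G.t 1)
  rw [hf, smul_dotProduct, chi_dotProduct, Pi.single_eq_same,
    Pi.single_eq_of_ne G.s_ne_t, sub_zero, smul_eq_mul, mul_one] at h1
  rw [h1]
  calc f ⬝ᵥ (G.B *ᵥ Pi.single G.t 1) ≤ ∑ _e : E, 2 * U := by
        refine Finset.sum_le_sum fun e _ => ?_
        have h2 : |(G.B *ᵥ Pi.single G.t (1 : ℝ)) e| ≤ 1 := by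
          rw [B_mulVec, Pi.single_apply, Pi.single_apply]
          split_ifs <;> norm_num
        calc _ ≤ |f e * (G.B *ᵥ Pi.single G.t (1 : ℝ)) e| := le_abs_self _
          _ = |f e| * |(G.B *ᵥ Pi.single G.t (1 : ℝ)) e| := abs_mul _ _
          _ ≤ G.cap e * 1 := mul_le_mul (hcap e) h2 (abs_nonneg _) (G.cap_pos e).le
          _ ≤ 2 * U := by rw [mul_one]; exact hP.cap_le e
    _ = _ := by simp

/-- Each edge contributes two terms, and each is at most 1 because moving to a feasible flow cannot
use up more than the residual capacity. -/
theorem dotProduct_grad_le {G : CapGraph V E} {f g : E → ℝ} (hf : ∀ e, |f e| ≤ G.cap e)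
    (hg : G.StrictlyFeasible g) : (f - g) ⬝ᵥ G.grad g ≤ 2 * Fintype.card E := by
  calc (f - g) ⬝ᵥ G.grad g ≤ ∑ _e : E, (2 : ℝ) := by
        refine Finset.sum_le_sum fun e _ => ?_
        have h := abs_le.mp (hf e)
        have h' := abs_lt.mp (hg e)
        have p3 : 0 < G.cap e - g e := by linarith
        have p4 : 0 < G.cap e + g e := by linarith
        have e1 : (f e - g e) / (G.cap e - g e) ≤ 1 := by rw [div_le_one p3]; linarith
        have e2 : -(f e - g e) / (G.cap e + g e) ≤ 1 := by rw [div_le_one p4]; linarith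
        have : (f - g) e * G.grad g e
            = (f e - g e) / (G.cap e - g e) + -(f e - g e) / (G.cap e + g e) := by
          simp only [Pi.sub_apply, grad]; ring
        linarith
    _ = _ := by simp; ring

/-- Testing the gradient against a flow of value `F` bounds `μ` times the drop. The reversed flow is
feasible too and gives the other sign, since `2F - μ ≥ μ`. -/
theorem IsCentralFlow.abs_chi_dotProduct_le {G : CapGraph V E} {F μ : ℝ} {g : E → ℝ}
    {φ : V → ℝ} (hg : G.IsCentralFlow F μ g) (hF : G.Routable F) (hμ : 0 < μ) (hμF : μ ≤ F)
    (hφ : G.grad g = G.B *ᵥ φ) : |G.chi ⬝ᵥ φ| ≤ 2 * Fintype.card E / μ := by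
  obtain ⟨f, hf, hcap⟩ := hF
  have h1 := dotProduct_grad_le hcap hg.1.1
  have h2 := dotProduct_grad_le (f := -f) (fun e => by simpa using hcap e) hg.1.1
  rw [hφ, ← transpose_mulVec_dotProduct, Matrix.mulVec_sub, hg.1.2] at h1 h2
  rw [hf, ← sub_smul, smul_dotProduct, smul_eq_mul] at h1
  rw [Matrix.mulVec_neg, hf, ← neg_smul, ← sub_smul, smul_dotProduct, smul_eq_mul] at h2
  have hm : (0 : ℝ) ≤ 2 * Fintype.card E := by positivity
  rw [le_div_iff₀ hμ]
  rcases abs_cases (G.chi ⬝ᵥ φ) with ⟨h, h'⟩ | ⟨h, h'⟩ <;> rw [h] <;> nlinarith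

/-- The two reciprocals differ by at most `2m/μ`, the drop along the edge. The smaller one is at
most `1/cap`, which is at most `m/μ` since `μ ≤ F ≤ m * cap`. -/
theorem IsPreconditioner.one_div_residual_le {G : CapGraph V E} {U F μ : ℝ} {P : Finset E}
    {g : E → ℝ} (hP : G.IsPreconditioner U P) (hg : G.IsCentralFlow F μ g) (hF : G.Routable F)
    (hμ : 0 < μ) (hμF : μ ≤ F) {e : E} (he : e ∈ P) :
    1 / (G.cap e - g e) ≤ 3 * Fintype.card E / μ ∧
      1 / (G.cap e + g e) ≤ 3 * Fintype.card E / μ := by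
  obtain ⟨φ, hφ⟩ := hg.exists_grad_eq
  have h1 := hg.abs_chi_dotProduct_le hF hμ hμF hφ
  rw [← (sq_eq_sq_iff_abs_eq_abs _ _).mp (hP.B_mulVec_sq he φ), ← hφ, grad] at h1
  have h2 : 1 / G.cap e ≤ Fintype.card E / μ := by
    rw [div_le_div_iff₀ (G.cap_pos e) hμ, (hP.2.1 e he).2, one_mul]
    exact hμF.trans (hP.flow_le hF)
  have h3 := abs_le.mp h1
  have e1 : 2 * (Fintype.card E : ℝ) / μ + Fintype.card E / μ = 3 * Fintype.card E / μ := by ring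
  have hb := abs_lt.mp (hg.1.1 e)
  have hc := G.cap_pos e
  have hm : 0 ≤ 2 * (Fintype.card E : ℝ) / μ := by positivity
  rcases le_total 0 (g e) with h | h
  · have h4 : 1 / (G.cap e + g e) ≤ 1 / G.cap e :=
      one_div_le_one_div_of_le hc (by linarith)
    constructor <;> linarith
  · have h4 : 1 / (G.cap e - g e) ≤ 1 / G.cap e :=
      one_div_le_one_div_of_le hc (by linarith)
    constructor <;> linarith

/-- The resistances of the preconditioning edges at a central flow. -/
theorem IsPreconditioner.res_le {G : CapGraph V E} {U F μ : ℝ} {P : Finset E}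
    {g : E → ℝ} (hP : G.IsPreconditioner U P) (hg : G.IsCentralFlow F μ g) (hF : G.Routable F)
    (hμ : 0 < μ) (hμF : μ ≤ F) {e : E} (he : e ∈ P) :
    G.res g e ≤ 18 * (Fintype.card E : ℝ) ^ 2 / μ ^ 2 := by
  obtain ⟨h1, h2⟩ := hP.one_div_residual_le hg hF hμ hμF he
  have hb := abs_lt.mp (hg.1.1 e)
  have p3 : 0 < 1 / (G.cap e - g e) := one_div_pos.mpr (by linarith)
  have p4 : 0 < 1 / (G.cap e + g e) := one_div_pos.mpr (by linarith)
  have q1 := pow_le_pow_left₀ p3.le h1 2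
  have q2 := pow_le_pow_left₀ p4.le h2 2
  rw [div_pow, one_pow] at q1 q2
  calc G.res g e ≤ (3 * Fintype.card E / μ) ^ 2 + (3 * Fintype.card E / μ) ^ 2 := add_le_add q1 q2
    _ = _ := by ring

/-- The preconditioning edges carry an `s`-`t` flow of small energy; dually: -/
theorem IsPreconditioner.chi_dotProduct_sq_le {G : CapGraph V E} {U Q : ℝ} {P : Finset E}
    {r : E → ℝ} (hP : G.IsPreconditioner U P) (hr : ∀ e, 0 < r e) (hQ : ∀ e ∈ P, r e ≤ Q)
    (y : V → ℝ) :
    Fintype.card E * (G.chi ⬝ᵥ y) ^ 2 ≤ 2 * Q * wnorm (fun e => (r e)⁻¹) (G.B *ᵥ y) ^ 2 := by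
  have h1 : (Fintype.card E : ℝ) ≤ 2 * P.card := by exact_mod_cast hP.1
  have h2 : (P.card : ℝ) * (G.chi ⬝ᵥ y) ^ 2 ≤ Q * wnorm (fun e => (r e)⁻¹) (G.B *ᵥ y) ^ 2 := by
    calc (P.card : ℝ) * (G.chi ⬝ᵥ y) ^ 2 = ∑ e ∈ P, (G.chi ⬝ᵥ y) ^ 2 := by simp
      _ ≤ ∑ e ∈ P, Q * ((r e)⁻¹ * (G.B *ᵥ y) e ^ 2) := by
          refine Finset.sum_le_sum fun e he => ?_
          rw [hP.B_mulVec_sq he, ← mul_assoc]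
          refine le_mul_of_one_le_left (sq_nonneg _) ?_
          rw [← div_eq_mul_inv, one_le_div (hr e)]
          exact hQ e he
      _ = Q * ∑ e ∈ P, (r e)⁻¹ * (G.B *ᵥ y) e ^ 2 := by rw [Finset.mul_sum]
      _ ≤ Q * wnorm (fun e => (r e)⁻¹) (G.B *ᵥ y) ^ 2 := by
          rw [wnorm_sq (fun e => (inv_pos.mpr (hr e)).le)]
          rcases P.eq_empty_or_nonempty with rfl | ⟨e, he⟩
          · have hE : (Fintype.card E : ℕ) = 0 := by simpa using hP.1
            have : IsEmpty E := Fintype.card_eq_zero_iff.mp hE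
            simp
          · refine mul_le_mul_of_nonneg_left (Finset.sum_le_sum_of_subset_of_nonneg
              (Finset.subset_univ P) fun e _ _ => ?_) ((hr e).le.trans (hQ e he))
            have := hr e
            positivity
  nlinarith [sq_nonneg (G.chi ⬝ᵥ y)]

/-- Two central flows whose path parameters differ little have a small secant energy. -/
theorem IsPreconditioner.dotProduct_grad_sub_le {G : CapGraph V E} {U F μ₁ μ₂ ν : ℝ}
    {P : Finset E} {f g : E → ℝ} (hP : G.IsPreconditioner U P) (hF : G.Routable F)
    (hf : G.IsCentralFlow F μ₁ f) (hg : G.IsCentralFlow F μ₂ g) (hν : 0 < ν)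
    (h₁ : ν ≤ μ₁) (h₂ : ν ≤ μ₂) (h₁F : μ₁ ≤ F) (h₂F : μ₂ ≤ F) :
    (f - g) ⬝ᵥ (G.grad f - G.grad g) ≤ 36 * Fintype.card E * (μ₁ - μ₂) ^ 2 / ν ^ 2 := by
  obtain ⟨φ, hφ⟩ := hf.exists_grad_eq
  obtain ⟨ψ, hψ⟩ := hg.exists_grad_eq
  set m : ℝ := ((Fintype.card E : ℕ) : ℝ) with hm
  have hm0 : 0 ≤ m := by positivity
  set D := G.chi ⬝ᵥ (φ - ψ) with hD
  have hsub : G.grad f - G.grad g = G.B *ᵥ (φ - ψ) := by rw [hφ, hψ, Matrix.mulVec_sub]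
  have hS : (f - g) ⬝ᵥ (G.grad f - G.grad g) = (μ₂ - μ₁) * D := by
    rw [hsub, ← transpose_mulVec_dotProduct, Matrix.mulVec_sub, hf.1.2, hg.1.2, ← sub_smul,
      smul_dotProduct, smul_eq_mul]
    ring
  -- On a preconditioning edge `D` is, up to sign, the flow difference times the secant weight, and
  -- that weight is at most `2 * (3m/ν)²`. Summing over at least `m/2` such edges bounds `D²` by the
  -- full pairing `(μ₂ - μ₁) * D`.
  have hmD : m * D ^ 2 ≤ 2 * (18 * m ^ 2 / ν ^ 2) * ((μ₂ - μ₁) * D) := by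
    have h1 : m ≤ 2 * P.card := by rw [hm]; exact_mod_cast hP.1
    have h2 : (P.card : ℝ) * D ^ 2 ≤ 18 * m ^ 2 / ν ^ 2 * ((μ₂ - μ₁) * D) := by
      rw [← hS, dotProduct_grad_sub hf.1.1 hg.1.1]
      calc (P.card : ℝ) * D ^ 2 = ∑ e ∈ P, D ^ 2 := by simp
        _ ≤ ∑ e ∈ P, 18 * m ^ 2 / ν ^ 2 * ((f e - g e) ^ 2 *
            (1 / ((G.cap e - f e) * (G.cap e - g e))
              + 1 / ((G.cap e + f e) * (G.cap e + g e)))) := by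
            refine Finset.sum_le_sum fun e he => ?_
            obtain ⟨a1, a2⟩ := hP.one_div_residual_le hf hF (hν.trans_le h₁) h₁F he
            obtain ⟨b1, b2⟩ := hP.one_div_residual_le hg hF (hν.trans_le h₂) h₂F he
            have t : ∀ x, ν ≤ x → 3 * m / x ≤ 3 * m / ν := fun x hx =>
              div_le_div_of_nonneg_left (by positivity) hν hx
            have hb := abs_lt.mp (hf.1.1 e)
            have hb' := abs_lt.mp (hg.1.1 e)
            have p1 : 0 < 1 / (G.cap e - f e) := one_div_pos.mpr (by linarith)
            have p2 : 0 < 1 / (G.cap e + f e) := one_div_pos.mpr (by linarith)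
            have p3 : 0 < 1 / (G.cap e - g e) := one_div_pos.mpr (by linarith)
            have p4 : 0 < 1 / (G.cap e + g e) := one_div_pos.mpr (by linarith)
            have hsec : 1 / ((G.cap e - f e) * (G.cap e - g e))
                + 1 / ((G.cap e + f e) * (G.cap e + g e)) ≤ 18 * m ^ 2 / ν ^ 2 := by
              rw [← one_div_mul_one_div, ← one_div_mul_one_div]
              calc _ ≤ 3 * m / ν * (3 * m / ν) + 3 * m / ν * (3 * m / ν) :=
                    add_le_add
                      (mul_le_mul (a1.trans (t _ h₁)) (b1.trans (t _ h₂)) p3.le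
                        (p1.le.trans (a1.trans (t _ h₁))))
                      (mul_le_mul (a2.trans (t _ h₁)) (b2.trans (t _ h₂)) p4.le
                        (p2.le.trans (a2.trans (t _ h₁))))
                _ = _ := by ring
            have hDe : D ^ 2 = (G.grad f e - G.grad g e) ^ 2 := by
              rw [hD, ← hP.B_mulVec_sq he, ← hsub, Pi.sub_apply]
            rw [hDe, grad, grad, barrierDeriv_sub (hf.1.1 e) (hg.1.1 e)]
            have hpos := secant_pos hf.1.1 hg.1.1 e
            set c := 1 / ((G.cap e - f e) * (G.cap e - g e))
                + 1 / ((G.cap e + f e) * (G.cap e + g e))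
            calc ((f e - g e) * c) ^ 2 = ((f e - g e) ^ 2 * c) * c := by ring
              _ ≤ ((f e - g e) ^ 2 * c) * (18 * m ^ 2 / ν ^ 2) := by gcongr
              _ = _ := by ring
        _ = 18 * m ^ 2 / ν ^ 2 * ∑ e ∈ P, ((f e - g e) ^ 2 *
            (1 / ((G.cap e - f e) * (G.cap e - g e))
              + 1 / ((G.cap e + f e) * (G.cap e + g e)))) := by rw [Finset.mul_sum]
        _ ≤ _ := by
            refine mul_le_mul_of_nonneg_left (Finset.sum_le_sum_of_subset_of_nonneg
              (Finset.subset_univ P) fun e _ _ => ?_) (by positivity)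
            exact mul_nonneg (sq_nonneg _) (secant_pos hf.1.1 hg.1.1 e).le
    nlinarith [sq_nonneg D]
  rw [hS]
  set θ := μ₂ - μ₁ with hθ
  have hθ' : (μ₁ - μ₂) ^ 2 = θ ^ 2 := by rw [hθ]; ring
  rw [hθ']
  obtain h | h := hm0.eq_or_lt
  · have : IsEmpty E := Fintype.card_eq_zero_iff.mp (Nat.cast_eq_zero (R := ℝ).mp h.symm)
    rw [← hS, ← h]
    simp [dotProduct]
  · have hD2 : D ^ 2 ≤ 36 * m / ν ^ 2 * (θ * D) := by
      have : m * D ^ 2 ≤ m * (36 * m / ν ^ 2 * (θ * D)) := by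
        calc _ ≤ _ := hmD
          _ = _ := by ring
      exact le_of_mul_le_mul_left this h
    have hA : 0 ≤ 36 * m / ν ^ 2 := by positivity
    calc θ * D ≤ 36 * m / ν ^ 2 * θ ^ 2 := by
          set A := 36 * m / ν ^ 2
          by_contra hc
          push Not at hc
          have hx : 0 < θ * D := lt_of_le_of_lt (by positivity) hc
          have h3 : θ ^ 2 * D ^ 2 ≤ θ ^ 2 * (A * (θ * D)) :=
            mul_le_mul_of_nonneg_left hD2 (sq_nonneg _)
          nlinarith
      _ = _ := by ring

theorem IsPreconditioner.res_le_mul_res {G : CapGraph V E} {U F μ₁ μ₂ ν : ℝ}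
    {P : Finset E} {f g : E → ℝ} (hP : G.IsPreconditioner U P) (hF : G.Routable F)
    (hf : G.IsCentralFlow F μ₁ f) (hg : G.IsCentralFlow F μ₂ g) (hν : 0 < ν)
    (h₁ : ν ≤ μ₁) (h₂ : ν ≤ μ₂) (h₁F : μ₁ ≤ F) (h₂F : μ₂ ≤ F) (e : E) :
    G.res f e ≤ (36 * Fintype.card E * (μ₁ - μ₂) ^ 2 / ν ^ 2 + 2) ^ 2 * G.res g e := by
  refine resistance_le_of_secant_le (hf.1.1 e) (hg.1.1 e) ?_
  refine le_trans ?_ (hP.dotProduct_grad_sub_le hF hf hg hν h₁ h₂ h₁F h₂F)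
  rw [dotProduct_grad_sub hf.1.1 hg.1.1]
  exact Finset.single_le_sum (f := fun e => (f e - g e) ^ 2 *
      (1 / ((G.cap e - f e) * (G.cap e - g e)) + 1 / ((G.cap e + f e) * (G.cap e + g e))))
    (fun e _ => mul_nonneg (sq_nonneg _) (secant_pos hf.1.1 hg.1.1 e).le) (Finset.mem_univ e)

end CapGraph
namespace CapGraph
variable {V E : Type*} [Fintype V] [Fintype E] [DecidableEq V] [DecidableEq E]

/-! ### Moving a strictly feasible flow by a short vector -/

theorem StrictlyFeasible.of_wnorm_sub_le {G : CapGraph V E} {f g : E → ℝ} {ρ : ℝ}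
    (hf : G.StrictlyFeasible f) (hρ : 0 ≤ ρ) (hρ1 : ρ < 1)
    (h : wnorm (G.res f) (g - f) ≤ ρ) : G.StrictlyFeasible g := fun e =>
  abs_lt_of_residual (hf e) hρ hρ1
    ((mul_sq_le_wnorm_sq (fun e => (res_pos hf e).le) (g - f) e).trans
      (pow_le_pow_left₀ (wnorm_nonneg _ _) h 2))

theorem StrictlyFeasible.res_mul_le {G : CapGraph V E} {f g : E → ℝ} {ρ : ℝ}
    (hf : G.StrictlyFeasible f) (hρ : 0 ≤ ρ) (hρ1 : ρ < 1)
    (h : wnorm (G.res f) (g - f) ≤ ρ) (e : E) :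
    (1 - ρ) ^ 2 * G.res g e ≤ G.res f e ∧ G.res f e ≤ (1 + ρ) ^ 2 * G.res g e :=
  resistance_mul_le (hf e) hρ hρ1
    ((mul_sq_le_wnorm_sq (fun e => (res_pos hf e).le) (g - f) e).trans
      (pow_le_pow_left₀ (wnorm_nonneg _ _) h 2))

/-- Multiplication by the resistances is an isometry onto the dual norm. -/
theorem wnorm_inv_mul {r : E → ℝ} (hr : ∀ e, 0 < r e) (z : E → ℝ) :
    wnorm (fun e => (r e)⁻¹) (fun e => r e * z e) = wnorm r z := by
  rw [← sq_eq_sq₀ (wnorm_nonneg _ _) (wnorm_nonneg _ _), wnorm_sq fun e => (hr e).le,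
    wnorm_sq fun e => (inv_pos.mpr (hr e)).le]
  refine Finset.sum_congr rfl fun e _ => ?_
  have := (hr e).ne'
  field_simp

/-- The gradient of the barrier is linear up to a second order error. -/
theorem StrictlyFeasible.wnorm_grad_sub_linear_le {G : CapGraph V E} {f g : E → ℝ} {ρ : ℝ}
    (hf : G.StrictlyFeasible f) (hρ : 0 ≤ ρ) (hρ1 : ρ < 1)
    (h : wnorm (G.res f) (g - f) ≤ ρ) :
    wnorm (fun e => (G.res f e)⁻¹)
      (G.grad g - G.grad f - fun e => G.res f e * (g - f) e) ≤ ρ / (1 - ρ) * ρ := by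
  have hq : 0 ≤ ρ / (1 - ρ) := div_nonneg hρ (by linarith)
  refine le_trans ?_ (mul_le_mul_of_nonneg_left h hq)
  rw [← wnorm_inv_mul (res_pos hf)]
  refine wnorm_le_mul (fun e => (inv_pos.mpr (res_pos hf e)).le)
    (fun e => (inv_pos.mpr (res_pos hf e)).le) hq fun e => ?_
  have h1 := abs_barrierDeriv_sub_linear_le (hf e) hρ hρ1
    ((mul_sq_le_wnorm_sq (fun e => (res_pos hf e).le) (g - f) e).trans
      (pow_le_pow_left₀ (wnorm_nonneg _ _) h 2))
  have hr := res_pos hf e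
  have h2 : (G.grad g - G.grad f - fun e => G.res f e * (g - f) e) e ^ 2
      ≤ (ρ / (1 - ρ)) ^ 2 * (G.res f e * (g - f) e) ^ 2 := by
    have h3 := pow_le_pow_left₀ (abs_nonneg _) h1 2
    rw [sq_abs, mul_pow, mul_pow, sq_abs, ← mul_pow (1 / (G.cap e - f e) ^ 2 + _)] at h3
    exact h3
  calc _ ≤ (G.res f e)⁻¹ * ((ρ / (1 - ρ)) ^ 2 * (G.res f e * (g - f) e) ^ 2) :=
        mul_le_mul_of_nonneg_left h2 (inv_pos.mpr hr).le
    _ = _ := by ring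

/-- A flow with small centrality and demand errors is close to the central flow. -/
theorem IsCentralFlow.wnorm_sub_le {G : CapGraph V E} {F μ a : ℝ} {f g : E → ℝ} {φ : V → ℝ}
    (hg : G.IsCentralFlow F μ g) (hf : G.StrictlyFeasible f) (ha : 0 ≤ a) (ha' : a ≤ 1 / 1000)
    (hc : wnorm (fun e => (G.res f e)⁻¹) (G.grad f - G.B *ᵥ φ) ≤ a)
    (hd : ∀ y, |((G.B)ᵀ *ᵥ f - (F - μ) • G.chi) ⬝ᵥ y|
      ≤ a * wnorm (fun e => (G.res f e)⁻¹) (G.B *ᵥ y)) :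
    wnorm (G.res f) (g - f) ≤ 1 / 100 := by
  set r := G.res f with hr
  have hrp : ∀ e, 0 < r e := res_pos hf
  -- An electrical flow `z` of norm at most `a` repairs the demand. Then `h = f - z` routes exactly
  -- `F - μ`, and `w = h - g` is a circulation.
  set x := pinv (G.lap f) *ᵥ ((G.B)ᵀ *ᵥ f - (F - μ) • G.chi) with hx
  have hLx : G.lap f *ᵥ x = (G.B)ᵀ *ᵥ f - (F - μ) • G.chi := lap_mulVec_pinv hf hd
  set z : E → ℝ := fun e => (r e)⁻¹ * (G.B *ᵥ x) e with hz
  have hzn : wnorm r z ≤ a := by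
    rw [← wnorm_inv_mul hrp]
    have : (fun e => r e * z e) = G.B *ᵥ x := by
      ext e
      rw [hz, mul_inv_cancel_left₀ (hrp e).ne']
    rw [this]
    exact wnorm_B_pinv_le hf ha hd
  set h := f - z with hh
  have hhf : wnorm r (h - f) ≤ a := by
    have : h - f = fun e => -1 * z e := by ext e; simp [hh]
    rw [this]
    refine le_trans ?_ hzn
    refine (wnorm_le_mul (fun e => (hrp e).le) (fun e => (hrp e).le) zero_le_one
      fun e => ?_).trans (one_mul _).le
    exact le_of_eq (by ring)
  have ha1 : a < 1 := by linarith
  have hs : G.StrictlyFeasible h := hf.of_wnorm_sub_le ha ha1 hhf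
  have hBh : (G.B)ᵀ *ᵥ h = (F - μ) • G.chi := by
    rw [hh, Matrix.mulVec_sub, hz, ← lap_mulVec, hLx, sub_sub_cancel]
  have hres := hf.res_mul_le ha ha1 hhf
  set w := h - g with hw
  have hBw : (G.B)ᵀ *ᵥ w = 0 := by rw [hw, Matrix.mulVec_sub, hBh, hg.1.2, sub_self]
  set ρ := wnorm r w with hρ
  set σ := wnorm (G.res h) w with hσ
  have hρ0 : 0 ≤ ρ := wnorm_nonneg _ _
  have hσ0 : 0 ≤ σ := wnorm_nonneg _ _
  have hρσ : ρ ≤ (1 + a) * σ := by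
    refine wnorm_le_mul (fun e => (hrp e).le) (fun e => (res_pos hs e).le) (by linarith) fun e => ?_
    rw [← mul_assoc]
    exact mul_le_mul_of_nonneg_right (hres e).2 (sq_nonneg _)
  -- The three errors of size `a` are the nonlinearity between `f` and `h`, the centrality error of
  -- `f`, and the linear term `R(h - f)`. The gradient at `g` and `G.B *ᵥ φ` vanish on the
  -- circulation `w`.
  have hup : w ⬝ᵥ (G.grad h - G.grad g) ≤ ρ * (3 * a) := by
    have e0 : w ⬝ᵥ (G.B *ᵥ φ) = 0 := by
      rw [← transpose_mulVec_dotProduct, hBw, zero_dotProduct]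
    have e1 : w ⬝ᵥ (G.grad h - G.grad g) = w ⬝ᵥ ((G.grad h - G.grad f
        - fun e => r e * (h - f) e) + (G.grad f - G.B *ᵥ φ) + fun e => r e * (h - f) e) := by
      rw [dotProduct_sub, hg.dotProduct_grad_eq_zero hBw, dotProduct_add, dotProduct_add,
        dotProduct_sub, dotProduct_sub, dotProduct_sub, e0]
      ring
    rw [e1]
    refine (le_abs_self _).trans ((abs_dotProduct_le_wnorm hrp _ _).trans
      (mul_le_mul_of_nonneg_left ?_ hρ0))
    refine (wnorm_add_le _ _ _).trans ?_
    have t1 := (wnorm_add_le (fun e => (r e)⁻¹) (G.grad h - G.grad f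
        - fun e => r e * (h - f) e) (G.grad f - G.B *ᵥ φ))
    have t2 := hf.wnorm_grad_sub_linear_le ha ha1 hhf
    rw [wnorm_inv_mul hrp]
    have t3 : a / (1 - a) * a ≤ 1 * a := by
      refine mul_le_mul_of_nonneg_right ?_ ha
      rw [div_le_one (by linarith)]; linarith
    linarith
  -- The matching lower bound is monotonicity of the gradient. With `hup` it reads `σ ≤ (1 + σ) *
  -- O(a)`, which forces `σ` to be small.
  have hlo : σ ^ 2 ≤ (1 + σ) * (w ⬝ᵥ (G.grad h - G.grad g)) := by
    rw [hw, dotProduct_grad_sub hs hg.1.1, Finset.mul_sum, hσ, wnorm_sq fun e => (res_pos hs e).le]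
    refine Finset.sum_le_sum fun e _ => ?_
    have h1 := resistance_le_secant (hs e) (hg.1.1 e) hσ0
      (mul_sq_le_wnorm_sq (fun e => (res_pos hs e).le) w e)
    calc G.res h e * (h e - g e) ^ 2 ≤ _ := mul_le_mul_of_nonneg_right h1 (sq_nonneg _)
      _ = _ := by ring
  have h1 : σ ^ 2 ≤ (1 + σ) * (((1 + a) * σ) * (3 * a)) :=
    hlo.trans (mul_le_mul_of_nonneg_left
      (hup.trans (mul_le_mul_of_nonneg_right hρσ (by linarith))) (by linarith))
  have h2 : σ ≤ 4 / 1000 := by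
    by_contra hcon
    push Not at hcon
    have h3 : σ * σ ≤ σ * ((1 + σ) * ((1 + a) * (3 * a))) := by nlinarith
    have h4 := le_of_mul_le_mul_left h3 (by linarith)
    have h5 : (1 + a) * (3 * a) ≤ 31 / 10000 := by nlinarith
    nlinarith
  have e2 : g - f = (h - f) - w := by rw [hw]; abel
  rw [e2]
  refine (_root_.wnorm_sub_le _ _ _).trans ?_
  nlinarith

end CapGraph

/-! ### Approximate electrical flows -/

theorem abs_exp_sub_one_le_two_mul {ε : ℝ} (h0 : 0 ≤ ε) (h1 : ε ≤ 1) :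
    1 - 2 * ε ≤ Real.exp (-ε) ∧ Real.exp ε ≤ 1 + 2 * ε := by
  have a := Real.abs_exp_sub_one_le (x := ε) (by rwa [abs_of_nonneg h0])
  rw [abs_of_nonneg h0] at a
  have b := Real.add_one_le_exp (-ε)
  exact ⟨by linarith, by linarith [(abs_le.mp a).2]⟩

theorem RealApprox.abs_div_sub_one_le {ε a b : ℝ} (h : RealApprox ε a b) (h0 : 0 ≤ ε)
    (h1 : ε ≤ 1 / 1000) (hb : 0 < b) : 0 < a ∧ |b / a - 1| ≤ 3 * ε := by
  obtain ⟨e1, e2⟩ := abs_exp_sub_one_le_two_mul h0 (by linarith)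
  have l1 : (1 - 2 * ε) * b ≤ a := (mul_le_mul_of_nonneg_right e1 hb.le).trans h.1
  have l2 : a ≤ (1 + 2 * ε) * b := h.2.trans (mul_le_mul_of_nonneg_right e2 hb.le)
  have ha : 0 < a := lt_of_lt_of_le (mul_pos (by linarith) hb) l1
  refine ⟨ha, ?_⟩
  rw [abs_le, div_sub_one ha.ne', le_div_iff₀ ha, div_le_iff₀ ha]
  constructor
  · nlinarith
  · nlinarith [mul_nonneg h0 hb.le]

theorem MatApprox.transpose_eq {p : Type*} [Fintype p] {ε : ℝ} {A L : Matrix p p ℝ}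
    (h : MatApprox ε A L) (hL : Lᵀ = L) : Aᵀ = A := by
  have h1 := h.1.isHermitian
  rw [Matrix.IsHermitian, Matrix.conjTranspose_eq_transpose_of_trivial, Matrix.transpose_sub,
    Matrix.transpose_smul, hL] at h1
  exact sub_left_injective h1

theorem MatApprox.abs_dotProduct_sub_le {p : Type*} [Fintype p] {ε : ℝ} {A L : Matrix p p ℝ}
    (h : MatApprox ε A L) (h0 : 0 ≤ ε) (h1 : ε ≤ 1) {v : p → ℝ} (hv : 0 ≤ v ⬝ᵥ (L *ᵥ v)) :
    |v ⬝ᵥ ((A - L) *ᵥ v)| ≤ 2 * ε * (v ⬝ᵥ (L *ᵥ v)) := by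
  obtain ⟨e1, e2⟩ := abs_exp_sub_one_le_two_mul h0 h1
  have l1 := h.1.dotProduct_mulVec_nonneg v
  have l2 := h.2.dotProduct_mulVec_nonneg v
  simp only [star_trivial, Matrix.sub_mulVec, Matrix.smul_mulVec, dotProduct_sub,
    dotProduct_smul, smul_eq_mul] at l1 l2 ⊢
  rw [abs_le]
  constructor <;> nlinarith

namespace CapGraph
variable {V E : Type*} [Fintype V] [Fintype E] [DecidableEq V] [DecidableEq E]

/-- The potentials of an approximate electrical flow. -/
theorem IsPreconditioner.approx_potential {G : CapGraph V E} {U Q ε : ℝ} {P : Finset E}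
    {f : E → ℝ} {L : Matrix V V ℝ} (hP : G.IsPreconditioner U P) (hf : G.StrictlyFeasible f)
    (hE : 0 < Fintype.card E) (hQ : ∀ e ∈ P, G.res f e ≤ Q) (h0 : 0 ≤ ε) (h1 : ε ≤ 1 / 1000)
    (hL : MatApprox ε L (G.lap f)) :
    L *ᵥ (pinv L *ᵥ G.chi) = G.chi ∧
    Fintype.card E * wnorm (fun e => (G.res f e)⁻¹) (G.B *ᵥ (pinv L *ᵥ G.chi)) ^ 2 ≤ 3 * Q := by
  have hm : (0 : ℝ) < Fintype.card E := by exact_mod_cast hE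
  have hq : ∀ v : V → ℝ, v ⬝ᵥ (G.lap f *ᵥ v) = wnorm (fun e => (G.res f e)⁻¹) (G.B *ᵥ v) ^ 2 :=
    dotProduct_lap_self hf
  have hq' : ∀ v : V → ℝ, (1 - 2 * ε) * wnorm (fun e => (G.res f e)⁻¹) (G.B *ᵥ v) ^ 2
      ≤ v ⬝ᵥ (L *ᵥ v) := by
    intro v
    have h2 := hL.abs_dotProduct_sub_le h0 (by linarith) (v := v) (by rw [hq]; positivity)
    rw [Matrix.sub_mulVec, dotProduct_sub, hq] at h2
    linarith [(abs_le.mp h2).1]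
  have hχ := hP.chi_dotProduct_sq_le (res_pos hf) hQ
  have hsolve : L *ᵥ (pinv L *ᵥ G.chi) = G.chi := by
    refine mulVec_pinv_mulVec (hL.transpose_eq (G.lap_transpose f)) fun z hz => ?_
    have h2 := hq' z
    rw [hz, dotProduct_zero] at h2
    have h3 : wnorm (fun e => (G.res f e)⁻¹) (G.B *ᵥ z) ^ 2 ≤ 0 := by
      by_contra hc
      push Not at hc
      nlinarith
    have h4 := hχ z
    rw [le_antisymm h3 (sq_nonneg _), mul_zero] at h4
    have h5 : (G.chi ⬝ᵥ z) ^ 2 ≤ 0 := by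
      by_contra hc
      push Not at hc
      nlinarith [mul_pos hm hc]
    exact pow_eq_zero_iff two_ne_zero |>.mp (le_antisymm h5 (sq_nonneg _))
  refine ⟨hsolve, ?_⟩
  set x := pinv L *ᵥ G.chi with hx
  have h2 := hq' x
  rw [hsolve, dotProduct_comm] at h2
  have h3 := hχ x
  set N := wnorm (fun e => (G.res f e)⁻¹) (G.B *ᵥ x) ^ 2 with hN
  have hN0 : 0 ≤ N := sq_nonneg _
  rcases hN0.eq_or_lt with h | h
  · rw [← h, mul_zero]
    obtain ⟨e, he⟩ : P.Nonempty := by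
      rw [← Finset.card_pos]; have := hP.1; omega
    linarith [(res_pos hf e).trans_le (hQ e he)]
  -- The energy `N` is almost at most `χ·x`, while `m * (χ·x)² ≤ 2QN`. One factor `N` cancels.
  · have h4 : ((1 - 2 * ε) * N) ^ 2 ≤ (G.chi ⬝ᵥ x) ^ 2 :=
      pow_le_pow_left₀ (mul_nonneg (by linarith) hN0) h2 2
    have h5 : (9 / 10 : ℝ) ≤ (1 - 2 * ε) ^ 2 := by nlinarith
    have h6 : N * (9 / 10 * (Fintype.card E * N)) ≤ N * (2 * Q) := by
      calc N * (9 / 10 * (Fintype.card E * N)) = 9 / 10 * (Fintype.card E * N ^ 2) := by ring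
        _ ≤ (1 - 2 * ε) ^ 2 * (Fintype.card E * N ^ 2) :=
            mul_le_mul_of_nonneg_right h5 (by positivity)
        _ = Fintype.card E * ((1 - 2 * ε) * N) ^ 2 := by ring
        _ ≤ Fintype.card E * (G.chi ⬝ᵥ x) ^ 2 := mul_le_mul_of_nonneg_left h4 hm.le
        _ ≤ _ := h3
        _ = _ := by ring
    have h7 := le_of_mul_le_mul_left h6 h
    nlinarith [mul_pos hm h]

/-- One step along an approximate electrical flow: the step is short, and the errors in the
gradient and in the demand are of second order. -/
theorem approx_step {G : CapGraph V E} {ε δ : ℝ} {f : E → ℝ} {r : E → ℝ} {L : Matrix V V ℝ}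
    (hf : G.StrictlyFeasible f) (h0 : 0 ≤ ε) (h1 : ε ≤ 1 / 1000) (hδ : 0 ≤ δ)
    (hr : ∀ e, RealApprox ε (r e) (G.res f e)) (hL : MatApprox ε L (G.lap f))
    (hsolve : L *ᵥ (pinv L *ᵥ G.chi) = G.chi)
    (hN : δ * wnorm (fun e => (G.res f e)⁻¹) (G.B *ᵥ (pinv L *ᵥ G.chi)) ≤ 30 * ε) :
    wnorm (G.res f) (δ • G.elecFlow r L G.chi) ≤ 40 * ε ∧
    wnorm (fun e => (G.res f e)⁻¹) (G.grad (f + δ • G.elecFlow r L G.chi) - G.grad f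
      - δ • (G.B *ᵥ (pinv L *ᵥ G.chi))) ≤ 2000 * ε ^ 2 ∧
    ∀ y, |((G.B)ᵀ *ᵥ (δ • G.elecFlow r L G.chi) - δ • G.chi) ⬝ᵥ y|
      ≤ 2000 * ε ^ 2 * wnorm (fun e => (G.res f e)⁻¹) (G.B *ᵥ y) := by
  set x := pinv L *ᵥ G.chi with hx
  set ρ := G.res f with hρ
  have hρp : ∀ e, 0 < ρ e := res_pos hf
  set D := δ • G.elecFlow r L G.chi with hD
  set N := wnorm (fun e => (ρ e)⁻¹) (G.B *ᵥ x) with hNdef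
  have hN0 : 0 ≤ N := wnorm_nonneg _ _
  have hDe : ∀ e, D e = δ * ((r e)⁻¹ * (G.B *ᵥ x) e) := by
    intro e
    rw [hD, Pi.smul_apply, elecFlow, Matrix.mulVec_diagonal, smul_eq_mul]
  -- The flow with the same potentials but the exact resistances. Thus `D - q` carries only the
  -- error in the resistances, and `R q` is exactly the potential difference `δ • G.B *ᵥ x`.
  set q : E → ℝ := fun e => (ρ e)⁻¹ * (δ * (G.B *ᵥ x) e) with hq
  have hqN : wnorm ρ q ≤ δ * N := by
    refine wnorm_le_mul (fun e => (hρp e).le) (fun e => (inv_pos.mpr (hρp e)).le) hδ fun e => ?_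
    have := (hρp e).ne'
    refine le_of_eq ?_
    rw [hq]; field_simp
  have hzq : wnorm ρ (D - q) ≤ 3 * ε * wnorm ρ q := by
    refine wnorm_le_mul (fun e => (hρp e).le) (fun e => (hρp e).le) (by linarith) fun e => ?_
    obtain ⟨hre, h2⟩ := (hr e).abs_div_sub_one_le h0 h1 (hρp e)
    have h3 : (D - q) e = (ρ e / r e - 1) * q e := by
      have := (hρp e).ne'
      have := hre.ne'
      rw [Pi.sub_apply, hDe, hq]; field_simp
    have h4 : (ρ e / r e - 1) ^ 2 ≤ (3 * ε) ^ 2 := by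
      rw [← sq_abs]; exact pow_le_pow_left₀ (abs_nonneg _) h2 2
    rw [h3, mul_pow]
    calc ρ e * ((ρ e / r e - 1) ^ 2 * q e ^ 2) = (ρ e / r e - 1) ^ 2 * (ρ e * q e ^ 2) := by ring
      _ ≤ _ := mul_le_mul_of_nonneg_right h4 (mul_nonneg (hρp e).le (sq_nonneg _))
  have hz : wnorm ρ (D - q) ≤ 90 * ε ^ 2 := by
    calc wnorm ρ (D - q) ≤ 3 * ε * (30 * ε) :=
          hzq.trans (mul_le_mul_of_nonneg_left (hqN.trans hN) (by linarith))
      _ = _ := by ring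
  have hDn : wnorm ρ D ≤ 40 * ε := by
    have h2 : D = q + (D - q) := by abel
    rw [h2]
    refine (wnorm_add_le _ _ _).trans ?_
    nlinarith
  refine ⟨hDn, ?_, fun y => ?_⟩
  · have h40 : 40 * ε < 1 := by linarith
    have h2 := hf.wnorm_grad_sub_linear_le (g := f + D) (ρ := 40 * ε) (by linarith) h40
      (by rwa [add_sub_cancel_left])
    have h3 : G.grad (f + D) - G.grad f - δ • (G.B *ᵥ x)
        = (G.grad (f + D) - G.grad f - fun e => ρ e * (f + D - f) e)
          + fun e => ρ e * (D - q) e := by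
      ext e
      have := (hρp e).ne'
      simp only [Pi.add_apply, Pi.sub_apply, Pi.smul_apply, smul_eq_mul, hq]
      field_simp
      ring
    rw [h3]
    refine (wnorm_add_le _ _ _).trans ?_
    rw [wnorm_inv_mul hρp]
    have h4 : 40 * ε / (1 - 40 * ε) * (40 * ε) ≤ 1900 * ε ^ 2 := by
      rw [div_mul_eq_mul_div, div_le_iff₀ (by linarith)]
      nlinarith [sq_nonneg ε]
    nlinarith [sq_nonneg ε]
  -- Since `L *ᵥ x = χ` while `q` routes `δ • G.lap f *ᵥ x`, the demand error splits into the errors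
  -- of the resistances and of the Laplacian.
  · have h2 : (G.B)ᵀ *ᵥ D - δ • G.chi
        = (G.B)ᵀ *ᵥ (D - q) - δ • ((L - G.lap f) *ᵥ x) := by
      have e1 : (G.B)ᵀ *ᵥ q = δ • (G.lap f *ᵥ x) := by
        rw [lap_mulVec, ← Matrix.mulVec_smul]
        congr 1
        ext e
        simp only [hq, Pi.smul_apply, smul_eq_mul]
        ring
      rw [Matrix.mulVec_sub, e1, Matrix.sub_mulVec, hsolve, smul_sub]
      abel
    set M := wnorm (fun e => (ρ e)⁻¹) (G.B *ᵥ y) with hM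
    have hM0 : 0 ≤ M := wnorm_nonneg _ _
    have h3 : |((G.B)ᵀ *ᵥ (D - q)) ⬝ᵥ y| ≤ 90 * ε ^ 2 * M := by
      rw [transpose_mulVec_dotProduct]
      exact (abs_dotProduct_le_wnorm hρp _ _).trans (mul_le_mul_of_nonneg_right hz hM0)
    have h4 : |y ⬝ᵥ ((L - G.lap f) *ᵥ x)| ≤ 2 * ε * M * N := by
      refine abs_le_of_sq_le_sq ?_ (by positivity)
      have hsym : (L - G.lap f)ᵀ = L - G.lap f := by
        rw [Matrix.transpose_sub, hL.transpose_eq (G.lap_transpose f), G.lap_transpose f]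
      have h5 := sq_dotProduct_mulVec_le hsym (G.lap_transpose f)
        (fun v => hL.abs_dotProduct_sub_le h0 (by linarith) (v := v)
          (by rw [dotProduct_lap_self hf]; positivity)) x y
      rw [dotProduct_lap_self hf, dotProduct_lap_self hf] at h5
      calc _ ≤ _ := h5
        _ = _ := by ring
    rw [h2, sub_dotProduct, smul_dotProduct, smul_eq_mul, dotProduct_comm (_ *ᵥ x) y]
    refine (abs_sub _ _).trans ?_
    rw [abs_mul, abs_of_nonneg hδ]
    have h6 : δ * |y ⬝ᵥ ((L - G.lap f) *ᵥ x)| ≤ 60 * ε ^ 2 * M := by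
      calc _ ≤ δ * (2 * ε * M * N) := mul_le_mul_of_nonneg_left h4 hδ
        _ = 2 * ε * M * (δ * N) := by ring
        _ ≤ 2 * ε * M * (30 * ε) := mul_le_mul_of_nonneg_left hN (by positivity)
        _ = _ := by ring
    nlinarith [mul_nonneg (sq_nonneg ε) hM0]

end CapGraph

/-! ### Nearly central flows and the iteration -/

theorem wnorm_sub_comm {E : Type*} [Fintype E] (w x y : E → ℝ) :
    wnorm w (x - y) = wnorm w (y - x) := by
  have : (WithLp.toLp 2 (fun e => √(w e) * (x - y) e) : EuclideanSpace ℝ E)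
      = -WithLp.toLp 2 (fun e => √(w e) * (y - x) e) := by
    ext e; simp; ring
  rw [wnorm, this, norm_neg, wnorm]

theorem wnorm_inv_le_mul {E : Type*} [Fintype E] {r r' : E → ℝ} (hr : ∀ e, 0 < r e)
    (hr' : ∀ e, 0 < r' e) {K : ℝ} (hK : 0 ≤ K) (h : ∀ e, r e ≤ K ^ 2 * r' e) (x : E → ℝ) :
    wnorm (fun e => (r' e)⁻¹) x ≤ K * wnorm (fun e => (r e)⁻¹) x := by
  refine wnorm_le_mul (fun e => (inv_pos.mpr (hr' e)).le) (fun e => (inv_pos.mpr (hr e)).le) hK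
    fun e => ?_
  rw [← mul_assoc]
  refine mul_le_mul_of_nonneg_right ?_ (sq_nonneg _)
  rw [← div_eq_mul_inv, inv_eq_one_div, div_le_div_iff₀ (hr' e) (hr e), one_mul]
  exact h e

namespace CapGraph
variable {V E : Type*} [Fintype V] [Fintype E] [DecidableEq V] [DecidableEq E]

/-- `f` has centrality and demand errors at most `γ` for the path parameter `μ`, the latter
in its dual form. -/
def IsNearlyCentral (G : CapGraph V E) (F γ μ : ℝ) (f : E → ℝ) : Prop :=
  G.StrictlyFeasible f ∧
  (∃ φ, wnorm (fun e => (G.res f e)⁻¹) (G.grad f - G.B *ᵥ φ) ≤ γ) ∧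
  ∀ y, |((G.B)ᵀ *ᵥ f - (F - μ) • G.chi) ⬝ᵥ y| ≤ γ * wnorm (fun e => (G.res f e)⁻¹) (G.B *ᵥ y)

theorem IsNearlyCentral.isCentered {G : CapGraph V E} {F γ μ : ℝ} {f : E → ℝ} (hγ : 0 ≤ γ)
    (h : G.IsNearlyCentral F γ μ f) : G.IsCentered F γ μ f := by
  obtain ⟨hs, ⟨φ, hφ⟩, hd⟩ := h
  refine ⟨hs, ⟨φ, ?_⟩, matNorm_pinv_lap_le hs hγ hd⟩
  rw [matNorm_diagonal fun e => (inv_pos.mpr (res_pos hs e)).le, wnorm_sub_comm]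
  exact hφ

theorem IsNearlyCentral.wnorm_sub_le {G : CapGraph V E} {F μ : ℝ} {f g : E → ℝ}
    (h : G.IsNearlyCentral F (1 / 1000) μ f) (hg : G.IsCentralFlow F μ g) :
    wnorm (G.res f) (g - f) ≤ 1 / 100 := by
  obtain ⟨hs, ⟨φ, hφ⟩, hd⟩ := h
  exact hg.wnorm_sub_le hs (by norm_num) le_rfl hφ hd

theorem IsCentralFlow.isNearlyCentral {G : CapGraph V E} {F γ μ : ℝ} {g : E → ℝ} (hγ : 0 ≤ γ)
    (hg : G.IsCentralFlow F μ g) : G.IsNearlyCentral F γ μ g := by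
  obtain ⟨φ, hφ⟩ := hg.exists_grad_eq
  refine ⟨hg.1.1, ⟨φ, ?_⟩, fun y => ?_⟩
  · rw [hφ, sub_self, ← Finset.sum_empty (f := fun _ : E => (0 : E → ℝ))]
    exact (wnorm_sum_le _ _ _).trans (by simpa using hγ)
  · rw [hg.1.2, sub_self, zero_dotProduct, abs_zero]
    exact mul_nonneg hγ (wnorm_nonneg _ _)

theorem IsNearlyCentral.norm_le {G : CapGraph V E} {F μ : ℝ} {f g : E → ℝ}
    (h : G.IsNearlyCentral F (1 / 1000) μ f) (hg : G.IsCentralFlow F μ g) :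
    ‖fun e => Real.sqrt (G.res f e) * (f e - g e)‖ ≤ 1 / 10 := by
  rw [pi_norm_le_iff_of_nonneg (by norm_num)]
  intro e
  have h1 := mul_sq_le_wnorm_sq (fun e => (res_pos h.1 e).le) (g - f) e
  have h2 := pow_le_pow_left₀ (wnorm_nonneg _ _) (h.wnorm_sub_le hg) 2
  rw [Real.norm_eq_abs]
  refine abs_le_of_sq_le_sq ?_ (by norm_num)
  rw [mul_pow, Real.sq_sqrt (res_pos h.1 e).le]
  rw [Pi.sub_apply] at h1
  nlinarith

theorem IsNearlyCentral.matApprox {G : CapGraph V E} {F μ : ℝ} {f g : E → ℝ}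
    (h : G.IsNearlyCentral F (1 / 1000) μ f) (hg : G.IsCentralFlow F μ g) :
    MatApprox (1 / 5) (Matrix.diagonal (G.res f)) (Matrix.diagonal (G.res g)) := by
  have h1 := h.1.res_mul_le (by norm_num) (by norm_num) (h.wnorm_sub_le hg)
  have e1 : (6 / 5 : ℝ) ≤ Real.exp (1 / 5) := by linarith [Real.add_one_le_exp (1 / 5 : ℝ)]
  have e2 : Real.exp (-(1 / 5)) ≤ 5 / 6 := by
    rw [Real.exp_neg, inv_le_comm₀ (Real.exp_pos _) (by norm_num)]
    linarith
  rw [MatApprox, ← Matrix.diagonal_smul, ← Matrix.diagonal_smul, Matrix.diagonal_sub,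
    Matrix.diagonal_sub, Matrix.posSemidef_diagonal_iff, Matrix.posSemidef_diagonal_iff]
  constructor <;> intro e <;> have hp := res_pos hg.1.1 e <;> have h2 := h1 e <;>
    simp only [Pi.smul_apply, smul_eq_mul] <;> nlinarith

/-- Near two central flows whose path parameters differ little, the resistances are comparable. -/
theorem IsPreconditioner.res_le_of_isNearlyCentral {G : CapGraph V E} {U F μ μ₁ μ₂ k : ℝ}
    {P : Finset E} {f₁ f₂ : E → ℝ} (hP : G.IsPreconditioner U P) (hF : G.Routable F)
    (hμ : 0 < μ) (h₁ : μ / 4 ≤ μ₁) (h₂ : μ / 4 ≤ μ₂) (h₁F : μ₁ ≤ F)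
    (h₂F : μ₂ ≤ F) (hk : 1 ≤ k) (hθ : Fintype.card E * (μ₁ - μ₂) ^ 2 ≤ k ^ 2 * μ ^ 2)
    (hf₁ : G.IsNearlyCentral F (1 / 1000) μ₁ f₁) (hf₂ : G.IsNearlyCentral F (1 / 1000) μ₂ f₂)
    (e : E) : G.res f₁ e ≤ (600 * k ^ 2) ^ 2 * G.res f₂ e := by
  -- The comparison runs through the central flows: `f₁` to `g₁`, along the path to `g₂`, then to
  -- `f₂`. The constant is `36 * 16 = 576`, plus slack.
  obtain ⟨g₁, hg₁⟩ := exists_isCentralFlow hF (by linarith) h₁F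
  obtain ⟨g₂, hg₂⟩ := exists_isCentralFlow hF (by linarith) h₂F
  have a1 := (hf₁.1.res_mul_le (by norm_num) (by norm_num) (hf₁.wnorm_sub_le hg₁) e).2
  have a2 := (hf₂.1.res_mul_le (by norm_num) (by norm_num) (hf₂.wnorm_sub_le hg₂) e).1
  have a3 := hP.res_le_mul_res hF hg₁ hg₂ (by linarith : 0 < μ / 4) h₁ h₂ h₁F h₂F e
  have hk2 : 1 ≤ k ^ 2 := one_le_pow₀ hk
  have hS : 36 * (Fintype.card E : ℝ) * (μ₁ - μ₂) ^ 2 / (μ / 4) ^ 2 + 2 ≤ 578 * k ^ 2 := by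
    have : 36 * (Fintype.card E : ℝ) * (μ₁ - μ₂) ^ 2 / (μ / 4) ^ 2 ≤ 576 * k ^ 2 := by
      rw [div_le_iff₀ (by positivity)]
      nlinarith
    linarith
  have hS0 : 0 ≤ 36 * (Fintype.card E : ℝ) * (μ₁ - μ₂) ^ 2 / (μ / 4) ^ 2 + 2 := by positivity
  have p2 := res_pos hg₂.1.1 e
  have a4 : G.res g₁ e ≤ (578 * k ^ 2) ^ 2 * G.res g₂ e :=
    a3.trans (mul_le_mul_of_nonneg_right (pow_le_pow_left₀ hS0 hS 2) p2.le)
  have hk4 : 0 ≤ (k ^ 2) ^ 2 := by positivity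
  calc G.res f₁ e ≤ (1 + 1 / 100) ^ 2 * ((578 * k ^ 2) ^ 2 * G.res g₂ e) :=
        a1.trans (mul_le_mul_of_nonneg_left a4 (by norm_num))
    _ ≤ (600 * k ^ 2) ^ 2 * ((1 - 1 / 100) ^ 2 * G.res g₂ e) := by
        nlinarith [mul_nonneg hk4 p2.le]
    _ ≤ _ := mul_le_mul_of_nonneg_left a2 (by positivity)

/-- Closeness to the central flow passes the resistance bound on the preconditioning edges to `f`:
`18 * 16 = 288` becomes `300`. The energy bound `3Q` then gives the factor `30² = 900`. -/
theorem IsPreconditioner.approx_step_of_isNearlyCentral {G : CapGraph V E} {U F μ μ' ε : ℝ}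
    {P : Finset E} {f r : E → ℝ} {L : Matrix V V ℝ} (hP : G.IsPreconditioner U P)
    (hF : G.Routable F) (hE : 0 < Fintype.card E) (hμ : 0 < μ) (h₁ : μ / 4 ≤ μ') (h₁F : μ' ≤ F)
    (h0 : 0 ≤ ε) (h1 : ε ≤ 1 / 1000) (hf : G.IsNearlyCentral F (1 / 1000) μ' f)
    (hr : ∀ e, RealApprox ε (r e) (G.res f e)) (hL : MatApprox ε L (G.lap f)) :
    let δ := ε * μ / Real.sqrt (Fintype.card E)
    wnorm (G.res f) (δ • G.elecFlow r L G.chi) ≤ 40 * ε ∧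
    wnorm (fun e => (G.res f e)⁻¹) (G.grad (f + δ • G.elecFlow r L G.chi) - G.grad f
      - δ • (G.B *ᵥ (pinv L *ᵥ G.chi))) ≤ 2000 * ε ^ 2 ∧
    ∀ y, |((G.B)ᵀ *ᵥ (δ • G.elecFlow r L G.chi) - δ • G.chi) ⬝ᵥ y|
      ≤ 2000 * ε ^ 2 * wnorm (fun e => (G.res f e)⁻¹) (G.B *ᵥ y) := by
  intro δ
  have hm : (0 : ℝ) < Fintype.card E := by exact_mod_cast hE
  have hδ : 0 ≤ δ := by positivity
  obtain ⟨g, hg⟩ := exists_isCentralFlow hF (by linarith) h₁F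
  have hQ : ∀ e ∈ P, G.res f e ≤ 300 * (Fintype.card E : ℝ) ^ 2 / μ ^ 2 := by
    intro e he
    have a1 := (hf.1.res_mul_le (by norm_num) (by norm_num) (hf.wnorm_sub_le hg) e).2
    have a2 := hP.res_le hg hF (by linarith) h₁F he
    have a3 : 18 * (Fintype.card E : ℝ) ^ 2 / μ' ^ 2 ≤ 18 * (Fintype.card E : ℝ) ^ 2 / (μ / 4) ^ 2 := by
      gcongr
    have a4 : 18 * (Fintype.card E : ℝ) ^ 2 / (μ / 4) ^ 2
        = 288 * ((Fintype.card E : ℝ) ^ 2 / μ ^ 2) := by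
      field_simp; norm_num
    have a5 : 0 ≤ (Fintype.card E : ℝ) ^ 2 / μ ^ 2 := by positivity
    rw [mul_div_assoc]
    nlinarith
  obtain ⟨hsolve, hN⟩ := hP.approx_potential hf.1 hE hQ h0 h1 hL
  refine approx_step hf.1 h0 h1 hδ hr hL hsolve (abs_le_of_sq_le_sq' ?_ (by positivity)).2
  rw [mul_pow, div_pow, Real.sq_sqrt hm.le]
  set N := wnorm (fun e => (G.res f e)⁻¹) (G.B *ᵥ (pinv L *ᵥ G.chi)) ^ 2
  have hN' : N ≤ 900 * Fintype.card E / μ ^ 2 := by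
    refine le_of_mul_le_mul_left (hN.trans (le_of_eq ?_)) hm
    ring
  calc (ε * μ) ^ 2 / Fintype.card E * N
      ≤ (ε * μ) ^ 2 / Fintype.card E * (900 * Fintype.card E / μ ^ 2) := by gcongr
    _ = (30 * ε) ^ 2 := by field_simp; norm_num

/-- Short-step path following with approximate electrical flows keeps the iterates nearly
central. -/
theorem IsPreconditioner.isNearlyCentral_iterate {G : CapGraph V E} {U F μ c k ε : ℝ}
    {P : Finset E} {f : ℕ → E → ℝ} {r : ℕ → E → ℝ} {L : ℕ → Matrix V V ℝ}
    (hP : G.IsPreconditioner U P) (hF : G.Routable F) (hμ : 0 < μ) (hμF : μ ≤ F)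
    (hc : 0 < c) (hc' : c ≤ 1 / 10 ^ 10) (hk : 1 ≤ k)
    (hkm : k ≤ 3 / 4 * Real.sqrt (Fintype.card E)) (hε : ε = c / k ^ 3)
    (h0 : G.IsCentralFlow F μ (f 0))
    (hstep : ∀ i : ℕ, (i : ℝ) + 1 ≤ k / ε →
      (∀ e, RealApprox ε (r i e) (G.res (f i) e)) ∧ MatApprox ε (L i) (G.lap (f i)) ∧
      f (i + 1) = f i + (ε * μ / Real.sqrt (Fintype.card E)) • G.elecFlow (r i) (L i) G.chi)
    (n : ℕ) (hn : (n : ℝ) ≤ k / ε) :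
    μ / 4 ≤ μ - n * ε / Real.sqrt (Fintype.card E) * μ ∧
    G.IsNearlyCentral F (1 / 1000) (μ - n * ε / Real.sqrt (Fintype.card E) * μ) (f n) := by
  have hk0 : 0 < k := by linarith
  have hs : 0 < Real.sqrt (Fintype.card E) := by linarith
  have hm : (0 : ℝ) < Fintype.card E := Real.sqrt_pos.mp hs
  have hE : 0 < Fintype.card E := by exact_mod_cast hm
  have hss : Real.sqrt (Fintype.card E) ^ 2 = Fintype.card E := Real.sq_sqrt hm.le
  set s := Real.sqrt (Fintype.card E) with hsdef
  have hε0 : 0 < ε := by rw [hε]; positivity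
  have hεc : ε ≤ c := by
    rw [hε]; exact div_le_self hc.le (one_le_pow₀ hk)
  have hε1 : ε ≤ 1 / 1000 := by linarith
  have hεk : ε * k ^ 3 = c := by rw [hε]; field_simp
  set δ := ε * μ / s with hδ
  have hpar : ∀ j : ℕ, (j : ℝ) ≤ k / ε → μ / 4 ≤ μ - j * ε / s * μ ∧ μ - j * ε / s * μ ≤ F := by
    intro j hj
    rw [le_div_iff₀ hε0] at hj
    have h1 : j * ε / s ≤ 3 / 4 := by rw [div_le_iff₀ hs]; linarith
    have h2 : 0 ≤ j * ε / s := by positivity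
    constructor <;> nlinarith
  refine ⟨(hpar n hn).1, ?_⟩
  -- All earlier iterates are needed, because every past error is measured again in the norm of the
  -- newest iterate.
  induction n using Nat.strong_induction_on with
  | _ n ih =>
  rcases Nat.eq_zero_or_pos n with rfl | hpos
  · simpa using h0.isNearlyCentral (by norm_num)
  obtain ⟨l, rfl⟩ : ∃ l, n = l + 1 := ⟨n - 1, by omega⟩
  have hle : ∀ j, j < l + 1 → (j : ℝ) + 1 ≤ k / ε := fun j hj =>
    le_trans (by exact_mod_cast hj) hn
  have hnear : ∀ j, j < l + 1 → G.IsNearlyCentral F (1 / 1000) (μ - j * ε / s * μ) (f j) :=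
    fun j hj => ih j hj (by linarith [hle j hj])
  have hst : ∀ j, j < l + 1 → wnorm (G.res (f j)) (f (j + 1) - f j) ≤ 40 * ε ∧
      wnorm (fun e => (G.res (f j) e)⁻¹) (G.grad (f (j + 1)) - G.grad (f j)
        - δ • (G.B *ᵥ (pinv (L j) *ᵥ G.chi))) ≤ 2000 * ε ^ 2 ∧
      ∀ y, |((G.B)ᵀ *ᵥ (f (j + 1) - f j) - δ • G.chi) ⬝ᵥ y|
        ≤ 2000 * ε ^ 2 * wnorm (fun e => (G.res (f j) e)⁻¹) (G.B *ᵥ y) := by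
    intro j hj
    obtain ⟨h1, h2, h3⟩ := hstep j (hle j hj)
    have hj' : (j : ℝ) ≤ k / ε := by linarith [hle j hj]
    rw [h3, add_sub_cancel_left]
    exact hP.approx_step_of_isNearlyCentral hF hE hμ (hpar j hj').1 (hpar j hj').2 hε0.le hε1
      (hnear j hj) h1 h2
  have hl := hst l (Nat.lt_succ_self l)
  have hlc := (hnear l (Nat.lt_succ_self l)).1
  have hfs : G.StrictlyFeasible (f (l + 1)) :=
    hlc.of_wnorm_sub_le (by linarith) (by linarith) hl.1
  -- Centrality of the newest iterate is not yet known. It is compared with iterate `l`, one short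
  -- step away, which raises `600` to `700`.
  set K := 700 * k ^ 2 with hK
  have hK0 : 0 ≤ K := by positivity
  have hjl : ∀ j, j < l + 1 → ∀ e, G.res (f j) e ≤ (600 * k ^ 2) ^ 2 * G.res (f l) e ∧
      G.res (f l) e ≤ (600 * k ^ 2) ^ 2 * G.res (f j) e := by
    intro j hj e
    have hj' : (j : ℝ) ≤ k / ε := by linarith [hle j hj]
    have hl' : (l : ℝ) ≤ k / ε := by linarith [hle l (Nat.lt_succ_self l)]
    have hjl : (j : ℝ) ≤ l := by exact_mod_cast Nat.lt_succ_iff.mp hj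
    have e1 : (Fintype.card E : ℝ) * ((μ - j * ε / s * μ) - (μ - l * ε / s * μ)) ^ 2
        ≤ k ^ 2 * μ ^ 2 := by
      have e2 : (Fintype.card E : ℝ) * ((μ - j * ε / s * μ) - (μ - l * ε / s * μ)) ^ 2
          = ((l - j) * ε) ^ 2 * μ ^ 2 := by
        rw [← hss]; field_simp; ring
      rw [e2]
      refine mul_le_mul_of_nonneg_right (pow_le_pow_left₀ ?_ ?_ 2) (sq_nonneg _)
      · exact mul_nonneg (by linarith) hε0.le
      · rw [le_div_iff₀ hε0] at hl'
        have : 0 ≤ (j : ℝ) * ε := by positivity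
        linarith
    exact ⟨hP.res_le_of_isNearlyCentral hF hμ (hpar j hj').1 (hpar l hl').1 (hpar j hj').2
      (hpar l hl').2 hk e1 (hnear j hj) (hnear l (Nat.lt_succ_self l)) e,
      hP.res_le_of_isNearlyCentral hF hμ (hpar l hl').1 (hpar j hj').1 (hpar l hl').2
      (hpar j hj').2 hk (by rwa [← neg_sub, neg_sq]) (hnear l (Nat.lt_succ_self l))
      (hnear j hj) e⟩
  have hk4 : 0 ≤ (k ^ 2) ^ 2 := by positivity
  have hres : ∀ j, j < l + 1 → ∀ e, G.res (f j) e ≤ K ^ 2 * G.res (f (l + 1)) e := by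
    intro j hj e
    have a2 := (hlc.res_mul_le (by linarith) (by linarith) hl.1 e).2
    have p := res_pos hfs e
    have a3 : (1 + 40 * ε) ^ 2 ≤ 11 / 10 := by nlinarith
    calc G.res (f j) e ≤ (600 * k ^ 2) ^ 2 * (11 / 10 * G.res (f (l + 1)) e) :=
          (hjl j hj e).1.trans (mul_le_mul_of_nonneg_left
            (a2.trans (mul_le_mul_of_nonneg_right a3 p.le)) (by positivity))
      _ ≤ K ^ 2 * G.res (f (l + 1)) e := by
          rw [hK]; nlinarith [mul_nonneg hk4 p.le]
  have hres' : ∀ j, j < l + 1 → ∀ e, G.res (f (l + 1)) e ≤ K ^ 2 * G.res (f j) e := by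
    intro j hj e
    have a2 := (hlc.res_mul_le (by linarith) (by linarith) hl.1 e).1
    have a3 : (9 / 10 : ℝ) ≤ (1 - 40 * ε) ^ 2 := by nlinarith
    have a4 := mul_le_mul_of_nonneg_right a3 (res_pos hfs e).le
    have p := res_pos (hnear j hj).1 e
    calc G.res (f (l + 1)) e ≤ 10 / 9 * ((600 * k ^ 2) ^ 2 * G.res (f j) e) := by
          linarith [(hjl j hj e).2]
      _ ≤ K ^ 2 * G.res (f j) e := by
          rw [hK]; nlinarith [mul_nonneg hk4 p.le]
  have htrans : ∀ j, j < l + 1 → ∀ x, wnorm (fun e => (G.res (f (l + 1)) e)⁻¹) x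
      ≤ K * wnorm (fun e => (G.res (f j) e)⁻¹) x := fun j hj x =>
    wnorm_inv_le_mul (res_pos (hnear j hj).1) (res_pos hfs) hK0 (hres j hj) x
  have htrans' : ∀ j, j < l + 1 → ∀ x, wnorm (fun e => (G.res (f j) e)⁻¹) x
      ≤ K * wnorm (fun e => (G.res (f (l + 1)) e)⁻¹) x := fun j hj x =>
    wnorm_inv_le_mul (res_pos hfs) (res_pos (hnear j hj).1) hK0 (hres' j hj) x
  -- The error budget: `(l + 1) * ε ≤ k` leaves `1400000 * ε * k³ = 1400000 * c`. This is why `ε`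
  -- scales like `k⁻³`.
  have hsum : ((l + 1 : ℕ) : ℝ) * (K * (2000 * ε ^ 2)) ≤ 1 / 1000 := by
    rw [le_div_iff₀ hε0] at hn
    calc ((l + 1 : ℕ) : ℝ) * (K * (2000 * ε ^ 2))
        = ((l + 1 : ℕ) * ε) * (1400000 * (k ^ 2 * ε)) := by rw [hK]; ring
      _ ≤ k * (1400000 * (k ^ 2 * ε)) := by gcongr
      _ = 1400000 * (ε * k ^ 3) := by ring
      _ ≤ 1 / 1000 := by rw [hεk]; linarith
  obtain ⟨φ, hφ⟩ := h0.exists_grad_eq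
  -- The dual variable is the initial one plus the potentials of all steps, so that the centrality
  -- error telescopes into the errors of the single steps.
  refine ⟨hfs, ⟨φ + ∑ j ∈ Finset.range (l + 1), δ • (pinv (L j) *ᵥ G.chi), ?_⟩, fun y => ?_⟩
  · have htel : G.grad (f (l + 1))
        - G.B *ᵥ (φ + ∑ j ∈ Finset.range (l + 1), δ • (pinv (L j) *ᵥ G.chi))
        = ∑ j ∈ Finset.range (l + 1), (G.grad (f (j + 1)) - G.grad (f j)
          - δ • (G.B *ᵥ (pinv (L j) *ᵥ G.chi))) := by
      rw [Finset.sum_sub_distrib, Finset.sum_range_sub (fun j => G.grad (f j)), Matrix.mulVec_add,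
        ← hφ, Matrix.mulVec_sum]
      simp only [Matrix.mulVec_smul]
      abel
    rw [htel]
    refine (wnorm_sum_le _ _ _).trans (le_trans (Finset.sum_le_sum (g := fun _ =>
      K * (2000 * ε ^ 2)) fun j hj => ?_) (by simpa using hsum))
    have hj' := Finset.mem_range.mp hj
    exact (htrans j hj' _).trans (mul_le_mul_of_nonneg_left (hst j hj').2.1 hK0)
  · have htel : (G.B)ᵀ *ᵥ f (l + 1) - (F - (μ - (l + 1 : ℕ) * ε / s * μ)) • G.chi
        = ∑ j ∈ Finset.range (l + 1), ((G.B)ᵀ *ᵥ (f (j + 1) - f j) - δ • G.chi) := by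
      simp only [Matrix.mulVec_sub]
      rw [Finset.sum_sub_distrib, Finset.sum_range_sub (fun j => (G.B)ᵀ *ᵥ f j), h0.1.2,
        Finset.sum_const, Finset.card_range, ← Nat.cast_smul_eq_nsmul ℝ, smul_smul, sub_sub,
        ← add_smul]
      congr 2
      rw [hδ]; ring
    rw [htel, sum_dotProduct]
    refine (Finset.abs_sum_le_sum_abs _ _).trans ?_
    set M := wnorm (fun e => (G.res (f (l + 1)) e)⁻¹) (G.B *ᵥ y)
    have hM : 0 ≤ M := wnorm_nonneg _ _
    calc _ ≤ ∑ _j ∈ Finset.range (l + 1), K * (2000 * ε ^ 2) * M := by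
          refine Finset.sum_le_sum fun j hj => ?_
          have hj' := Finset.mem_range.mp hj
          refine ((hst j hj').2.2 y).trans ?_
          calc _ ≤ 2000 * ε ^ 2 * (K * M) :=
                mul_le_mul_of_nonneg_left (htrans' j hj' _) (by positivity)
            _ = _ := by ring
      _ = ((l + 1 : ℕ) * (K * (2000 * ε ^ 2))) * M := by
          rw [Finset.sum_const, Finset.card_range, nsmul_eq_mul]; ring
      _ ≤ _ := mul_le_mul_of_nonneg_right hsum hM

end CapGraph
end

/-- The norm on `E → ℝ` is the sup norm; it is at most the weighted Euclidean distance `1/100`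
obtained for nearly central flows. -/
theorem lemma6p10 :
    ∃ c₀ : ℝ, 0 < c₀ ∧
    ∀ (V E : Type*) [Fintype V] [Fintype E] [DecidableEq V] [DecidableEq E]
      (G : CapGraph V E) (U F μ c k εstep εsolve : ℝ)
      (f : ℕ → E → ℝ) (r : ℕ → E → ℝ) (L : ℕ → Matrix V V ℝ),
      G.Connected → G.IsPreconditioned U →
      G.Routable F → 0 < μ → μ ≤ F →
      0 < c → c ≤ c₀ →
      1 ≤ k → k ≤ 3 / 4 * Real.sqrt (Fintype.card E) →
      εstep = c / k ^ 3 → εsolve = c / k ^ 3 →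
      G.IsCentralFlow F μ (f 0) →
      (∀ i : ℕ, (i : ℝ) + 1 ≤ k / εstep →
        (∀ e, RealApprox εsolve (r i e) (G.res (f i) e)) ∧
        MatApprox εsolve (L i) (G.lap (f i)) ∧
        f (i + 1) = f i +
          (εstep * μ / Real.sqrt (Fintype.card E)) • G.elecFlow (r i) (L i) G.chi) →
      ∀ (i : ℕ) (μi : ℝ), (i : ℝ) ≤ k / εstep →
        μi = μ - i * εstep / Real.sqrt (Fintype.card E) * μ →
        G.IsCentered F (1 / 1000) μi (f i) ∧
        (∃! g, G.IsCentralFlow F μi g) ∧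
        ∀ g, G.IsCentralFlow F μi g →
          ‖fun e => Real.sqrt (G.res (f i) e) * (f i e - g e)‖ ≤ 1 / 10 ∧
          MatApprox (1 / 5) (Matrix.diagonal (G.res (f i))) (Matrix.diagonal (G.res g)) := by
  refine ⟨1 / 10 ^ 10, by norm_num, ?_⟩
  intro V E _ _ _ _ G U F μ c k εstep εsolve f r L _ hpre hF hμ hμF hc hc' hk hkm hε hε' h0 hstep
    i μi hi hμi
  obtain ⟨P, hP⟩ := hpre
  have hP' : G.IsPreconditioner U P := hP
  obtain rfl : εsolve = εstep := hε'.trans hε.symm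
  obtain ⟨hlo, hnear⟩ := hP'.isNearlyCentral_iterate hF hμ hμF hc hc' hk hkm hε h0 hstep i hi
  rw [← hμi] at hlo hnear
  have hμiF : μi ≤ F := by
    have hε0 : 0 < εsolve := by
      rw [hε]; exact div_pos hc (pow_pos (by linarith) 3)
    have : 0 ≤ i * εsolve / Real.sqrt (Fintype.card E) * μ := by positivity
    linarith
  obtain ⟨g, hg⟩ := CapGraph.exists_isCentralFlow hF (by linarith) hμiF
  exact ⟨hnear.isCentered (by norm_num), ⟨g, hg, fun g' hg' => hg'.unique hg⟩,
    fun g' hg' => ⟨hnear.norm_le hg', hnear.matApprox hg'⟩⟩
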